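/- Let $E_0,E_1,E_2$ be complex Banach spaces and let $\bullet:E_0\times E_1\to E_2$ be a multiplication, i.e. a continuous bilinear map of norm at most $1$. For a complex Banach space $E$ let $\mathcal S'(\mathbb R^d,E)=\mathcal L(\mathcal S(\mathbb R^d),E)$ be the space of $E$-valued temperate distributions, let $\langle x\rangle=(1+|x|^2)^{1/2}$, and for a non-zero window $g\in\mathcal S(\mathbb R^d)$ let $V_gf(x,\xi)=\langle f,M_\xi T_xg\rangle$, where $M_\xi T_x g(y)=e^{2\pi i y\cdot\xi}g(y-x)$ and the bracket is linear in $f$ and antilinear in the test function, be the short-time Fourier transform of $f\in\mathcal S'(\mathbb R^d,E)$. For $1\le p,q\le\infty$ and $r,s\in\mathbb R$ put \[ \|f\|_{M^{p,q}_{r,s}(E)}=\Big(\int_{\mathbb R^d}\Big(\int_{\mathbb R^d}|V_gf(x,\xi)|_E^p\langle x\rangle^{rp}\,dx\Big)^{q/p}\langle\xi\rangle^{sq}\,d\xi\Big)^{1/q}, \] \[ \|f\|_{W^{p,q}_{r,s}(E)}=\Big(\int_{\mathbb R^d}\Big(\int_{\mathbb R^d}|V_gf(x,\xi)|_E^p\langle\xi\rangle^{rp}\,d\xi\Big)^{q/p}\langle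 x\rangle^{sq}\,dx\Big)^{1/q}, \] with the usual modification if $p=\infty$ or $q=\infty$; $M^{p,q}_{r,s}(\mathbb R^d,E)$ and $W^{p,q}_{r,s}(\mathbb R^d,E)$ consist of the $f\in\mathcal S'(\mathbb R^d,E)$ for which the respective quantity is finite for some non-zero $g\in\mathcal S(\mathbb R^d)$. For $\mu\in\mathcal S'(\mathbb R^d,E_0)$ the Fourier multiplier with symbol $\mu$ is the linear map $\mu(D)f=\mathcal F^{-1}\mu*_\bullet f\in\mathcal S'(\mathbb R^d,E_2)$, whose domain consists of all $f\in\mathcal S'(\mathbb R^d,E_1)$ for which this convolution exists. Here $h=u*_\bullet v$ means that for all $\varphi,\psi\in\mathcal S(\mathbb R^d)$ and all $x\in\mathbb R^d$ the integral $\int_{\mathbb R^d}(u*\varphi)(x-y)\bullet(v*\psi)(y)\,dy$ converges absolutely and equals $(h*(\varphi*\psi))(x)$; such an $h\in\mathcal S'(\mathbb R^d,E_2)$ is unique. Let $1\le p,q\le\infty$, let $r,s,\delta\in\mathbb R$, and let $\mu\in W^{1,\infty}_{|r|,\delta}(\mathbb R^d,E_0)$. Then $M^{p,q}_{r,s}(\mathbb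 R^d,E_1)$ is contained in the domain of $\mu(D)$, and $\mu(D)$ is bounded from $M^{p,q}_{r,s}(\mathbb R^d,E_1)$ to $M^{p,q}_{r,s+\delta}(\mathbb R^d,E_2)$, with \[ \|\mu(D)f\|_{M^{p,q}_{r,s+\delta}(E_2)}\le C\,\|\mu\|_{W^{1,\infty}_{|r|,\delta}(E_0)}\,\|f\|_{M^{p,q}_{r,s}(E_1)},\qquad f\in M^{p,q}_{r,s}(\mathbb R^d,E_1). \] The three norms may be taken with respect to arbitrary non-zero windows $g_2,g_0,g_1\in\mathcal S(\mathbb R^d)$ respectively, and the constant $C$ depends only on $d,p,q,r,s,\delta$ and these windows, not on the spaces $E_j$, the multiplication, $\mu$ or $f$. -/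

import Mathlib

open MeasureTheory FourierTransform
open scoped SchwartzMap ENNReal NNReal

noncomputable section

namespace TimeFrequency

/-- The Euclidean space `ℝᵈ`. -/
abbrev Rd (d : ℕ) : Type := EuclideanSpace ℝ (Fin d)

/-- The weight `⟨x⟩ = (1 + |x|²)^{1/2}`. -/
def bracket {d : ℕ} (x : Rd d) : ℝ := Real.sqrt (1 + ‖x‖ ^ 2)

/-! ### Time-frequency shifts of test functions -/

/-- The character `y ↦ e^{-2πi y·ξ}`. -/
def character {d : ℕ} (ξ : Rd d) (y : Rd d) : ℂ :=
  Complex.exp (-(2 * Real.pi * Complex.I) * (inner ℝ y ξ : ℝ))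

lemma hasTemperateGrowth_cexp (c : ℂ) (hc : c.re = 0) :
    Function.HasTemperateGrowth (fun t : ℝ => Complex.exp (c * t)) := by
  have hd : ∀ n : ℕ, iteratedDeriv n (fun t : ℝ => Complex.exp (c * t)) =
      fun t : ℝ => c ^ n * Complex.exp (c * t) := by
    intro n
    induction n with
    | zero => simp
    | succ n ih =>
      rw [iteratedDeriv_succ, ih]
      ext t
      have h1 : HasDerivAt (fun t : ℝ => c * (t : ℂ)) c t := by
        simpa using (Complex.ofRealCLM.hasDerivAt (x := t)).const_mul c
      rw [(h1.cexp.const_mul (c ^ n)).deriv]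
      ring
  refine ⟨(contDiff_const.mul Complex.ofRealCLM.contDiff).cexp, fun n => ⟨0, ‖c‖ ^ n, fun t => ?_⟩⟩
  rw [norm_iteratedFDeriv_eq_norm_iteratedDeriv, hd]
  simp [Complex.norm_exp, hc]

lemma hasTemperateGrowth_character {d : ℕ} (ξ : Rd d) :
    Function.HasTemperateGrowth (character ξ) :=
  (hasTemperateGrowth_cexp (-(2 * Real.pi * Complex.I)) (by simp)).comp
    (Function.hasTemperateGrowth_inner_left ξ)

/-- The Schwartz function `y ↦ e^{-2πi y·ξ} conj (g (y - x))`, the complex conjugate of the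
time-frequency shift `M_ξ T_x g`. -/
def conjShift {d : ℕ} (g : 𝓢(Rd d, ℂ)) (x ξ : Rd d) : 𝓢(Rd d, ℂ) :=
  SchwartzMap.smulLeftCLM ℂ (character ξ)
    (SchwartzMap.postcompCLM (𝕜 := ℝ) (Complex.conjCLE : ℂ →L[ℝ] ℂ)
      (g.compSubConstCLM ℝ x))

lemma conjShift_apply {d : ℕ} (g : 𝓢(Rd d, ℂ)) (x ξ y : Rd d) :
    conjShift g x ξ y =
      Complex.exp (-(2 * Real.pi * Complex.I) * (inner ℝ y ξ : ℝ)) *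
        (starRingEnd ℂ) (g (y - x)) := by
  simp [conjShift, SchwartzMap.smulLeftCLM_apply_apply (hasTemperateGrowth_character ξ),
    character]

/-- The operator `φ ↦ φ (x - ·)` on Schwartz functions. -/
def reflectAt {d : ℕ} (x : Rd d) : 𝓢(Rd d, ℂ) →L[ℂ] 𝓢(Rd d, ℂ) :=
  SchwartzMap.compCLMOfAntilipschitz (g := fun y : Rd d => x - y) (K := 1) ℂ (by fun_prop)
    (fun _ _ => by simp)

lemma reflectAt_apply {d : ℕ} (x y : Rd d) (φ : 𝓢(Rd d, ℂ)) :
    reflectAt x φ y = φ (x - y) := rfl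

section Spaces

variable {d : ℕ} {E : Type*} [NormedAddCommGroup E] [NormedSpace ℂ E]

/-! ### Short-time Fourier transform, modulation spaces, Wiener amalgam spaces

An `E`-valued tempered distribution is a continuous linear map `𝓢(ℝᵈ) → E`; the pairing of `f`
with `g` that is antilinear in `g` is `f (conj g)`. -/

/-- The short-time Fourier transform `V_g f (x, ξ) = ⟨f, M_ξ T_x g⟩`. -/
def stft (g : 𝓢(Rd d, ℂ)) (f : 𝓢'(Rd d, E)) (x ξ : Rd d) : E := f (conjShift g x ξ)

/-- The norm of `M^{p,q}_{r,s}` with respect to the window `g`: the `L^p_r` norm in `x`,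
followed by the `L^q_s` norm in `ξ`. -/
def modulationNorm (g : 𝓢(Rd d, ℂ)) (p q : ℝ≥0∞) (r s : ℝ) (f : 𝓢'(Rd d, E)) : ℝ≥0∞ :=
  eLpNorm (fun ξ : Rd d =>
    eLpNorm (fun x : Rd d => bracket x ^ r * ‖stft g f x ξ‖) p volume *
      ENNReal.ofReal (bracket ξ ^ s)) q volume

/-- The norm of `W^{p,q}_{r,s}` with respect to the window `g`: the `L^p_r` norm in `ξ`,
followed by the `L^q_s` norm in `x`. -/
def amalgamNorm (g : 𝓢(Rd d, ℂ)) (p q : ℝ≥0∞) (r s : ℝ) (f : 𝓢'(Rd d, E)) : ℝ≥0∞ :=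
  eLpNorm (fun x : Rd d =>
    eLpNorm (fun ξ : Rd d => bracket ξ ^ r * ‖stft g f x ξ‖) p volume *
      ENNReal.ofReal (bracket x ^ s)) q volume

/-- Membership in the modulation space `M^{p,q}_{r,s}(ℝᵈ, E)`. -/
def MemModulation (p q : ℝ≥0∞) (r s : ℝ) (f : 𝓢'(Rd d, E)) : Prop :=
  ∃ g : 𝓢(Rd d, ℂ), g ≠ 0 ∧ modulationNorm g p q r s f < ∞

/-- Membership in the Wiener amalgam space `W^{p,q}_{r,s}(ℝᵈ, E)`. -/
def MemAmalgam (p q : ℝ≥0∞) (r s : ℝ) (f : 𝓢'(Rd d, E)) : Prop :=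
  ∃ g : 𝓢(Rd d, ℂ), g ≠ 0 ∧ amalgamNorm g p q r s f < ∞

/-- The (smooth) function `f * φ` for a tempered distribution `f` and a Schwartz function `φ`. -/
def smoothing (f : 𝓢'(Rd d, E)) (φ : 𝓢(Rd d, ℂ)) (x : Rd d) : E := f (reflectAt x φ)

end Spaces

/-- The convolution of two scalar Schwartz functions. -/
def schwartzConv {d : ℕ} (φ ψ : 𝓢(Rd d, ℂ)) : 𝓢(Rd d, ℂ) :=
  SchwartzMap.convolution (ContinuousLinearMap.mul ℂ ℂ) φ ψ

lemma schwartzConv_apply {d : ℕ} (φ ψ : 𝓢(Rd d, ℂ)) (x : Rd d) :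
    schwartzConv φ ψ x = ∫ y, φ y * ψ (x - y) := by
  rw [schwartzConv, SchwartzMap.convolution_apply]
  rfl

/-! ### Convolution of vector-valued tempered distributions -/

section Convolution

variable {d : ℕ} {E₀ E₁ E₂ : Type*}
  [NormedAddCommGroup E₀] [NormedSpace ℂ E₀]
  [NormedAddCommGroup E₁] [NormedSpace ℂ E₁]
  [NormedAddCommGroup E₂] [NormedSpace ℂ E₂]

/-- `h` is the convolution of the tempered distributions `u` and `v` with respect to the bilinear
map `B`: for all Schwartz functions `φ, ψ`, the convolution of the smooth functions `u * φ` and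
`v * ψ` exists as an absolutely convergent integral, and `(u * φ) * (v * ψ) = h * (φ * ψ)`.
This is the classical (Chevalley) definition of the convolution of two tempered distributions. -/
def IsConvolution (B : E₀ →L[ℂ] E₁ →L[ℂ] E₂)
    (u : 𝓢'(Rd d, E₀)) (v : 𝓢'(Rd d, E₁)) (h : 𝓢'(Rd d, E₂)) : Prop :=
  ∀ (φ ψ : 𝓢(Rd d, ℂ)) (x : Rd d),
    Integrable (fun y : Rd d => B (smoothing u φ (x - y)) (smoothing v ψ y)) ∧
    ∫ y : Rd d, B (smoothing u φ (x - y)) (smoothing v ψ y) = smoothing h (schwartzConv φ ψ) x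

/-- The set of pairs `(v, h)` such that `h` is the convolution of `u` and `v`. -/
def convolutionGraph (B : E₀ →L[ℂ] E₁ →L[ℂ] E₂) (u : 𝓢'(Rd d, E₀)) :
    Submodule ℂ (𝓢'(Rd d, E₁) × 𝓢'(Rd d, E₂)) where
  carrier := {z | IsConvolution B u z.1 z.2}
  zero_mem' := by
    intro φ ψ x
    simp [smoothing]
  add_mem' := by
    intro a b ha hb φ ψ x
    have h1 := ha φ ψ x
    have h2 := hb φ ψ x
    have e : (fun y : Rd d => B (smoothing u φ (x - y)) (smoothing (a + b).1 ψ y)) =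
        fun y => B (smoothing u φ (x - y)) (smoothing a.1 ψ y) +
          B (smoothing u φ (x - y)) (smoothing b.1 ψ y) := by
      ext y; simp [smoothing]
    rw [e]
    refine ⟨h1.1.add h2.1, ?_⟩
    rw [integral_add h1.1 h2.1, h1.2, h2.2]
    simp [smoothing]
  smul_mem' := by
    intro c a ha φ ψ x
    have h1 := ha φ ψ x
    have e : (fun y : Rd d => B (smoothing u φ (x - y)) (smoothing (c • a).1 ψ y)) =
        fun y => c • B (smoothing u φ (x - y)) (smoothing a.1 ψ y) := by
      ext y; simp [smoothing]
    rw [e]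
    refine ⟨h1.1.smul c, ?_⟩
    rw [integral_smul, h1.2]
    simp [smoothing]

/-- The Fourier multiplier `μ(D) f = 𝓕⁻¹ μ * f`, as a linear map whose domain consists of all
`f` for which the convolution exists. -/
def fourierMultiplier (B : E₀ →L[ℂ] E₁ →L[ℂ] E₂) (μ : 𝓢'(Rd d, E₀)) :
    𝓢'(Rd d, E₁) →ₗ.[ℂ] 𝓢'(Rd d, E₂) :=
  (convolutionGraph B (𝓕⁻ μ)).toLinearPMap

/-! The convolution is unique when it exists, so that the linear map above is well defined. -/

/-- The cut-off functions `χ (c x)`, `χ 0 = 1`, act on Schwartz functions as an approximate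
identity when `c → 0`. -/
lemma seminorm_cutoff_le (χ θ : 𝓢(Rd d, ℂ)) (hχ : χ 0 = 1) (k l : ℕ) :
    ∃ M : ℝ, ∀ c : ℝ, 0 < c → c ≤ 1 → ∀ w : 𝓢(Rd d, ℂ),
      (∀ x, w x = (χ (c • x) - 1) * θ x) → SchwartzMap.seminorm ℂ k l w ≤ c * M := by
  let P : ℕ → ℝ := fun i => SchwartzMap.seminorm ℂ 0 i χ + SchwartzMap.seminorm ℂ 0 1 χ
  let M : ℝ := ∑ i ∈ Finset.range (l + 1), (l.choose i : ℝ) * P i *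
    (SchwartzMap.seminorm ℂ k (l - i) θ + SchwartzMap.seminorm ℂ (k + 1) (l - i) θ)
  have hP : ∀ i, 0 ≤ P i := fun i => add_nonneg (apply_nonneg _ _) (apply_nonneg _ _)
  have hM : 0 ≤ M := Finset.sum_nonneg fun i _ => mul_nonneg (mul_nonneg (by positivity) (hP i))
    (add_nonneg (apply_nonneg _ _) (apply_nonneg _ _))
  refine ⟨M, fun c hc hc1 w hw => ?_⟩
  have hχs : ContDiff ℝ (⊤ : ℕ∞) χ := χ.smooth ⊤
  have hWs : ContDiff ℝ (⊤ : ℕ∞) (fun x : Rd d => χ (c • x) - 1) :=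
    (hχs.comp (contDiff_const_smul c)).sub contDiff_const
  have hW : ∀ i x, ‖iteratedFDeriv ℝ i (fun x : Rd d => χ (c • x) - 1) x‖ ≤
      c * (P i * (1 + ‖x‖)) := by
    intro i x
    rcases Nat.eq_zero_or_pos i with rfl | hi
    · rw [norm_iteratedFDeriv_zero]
      have hlip : ‖χ (c • x) - χ 0‖ ≤ SchwartzMap.seminorm ℂ 0 1 χ * ‖c • x - 0‖ := by
        apply Convex.norm_image_sub_le_of_norm_fderiv_le (𝕜 := ℝ) (s := Set.univ)
          (fun y _ => χ.differentiableAt) _ convex_univ (Set.mem_univ _) (Set.mem_univ _)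
        intro y _
        have := SchwartzMap.le_seminorm ℂ 0 1 χ y
        simpa [norm_iteratedFDeriv_one] using this
      rw [hχ, sub_zero, norm_smul, Real.norm_of_nonneg hc.le] at hlip
      have h0 : SchwartzMap.seminorm ℂ 0 1 χ ≤ P 0 := le_add_of_nonneg_left (apply_nonneg _ _)
      calc _ ≤ SchwartzMap.seminorm ℂ 0 1 χ * (c * ‖x‖) := hlip
        _ ≤ P 0 * (c * (1 + ‖x‖)) := by
          apply mul_le_mul h0 _ (by positivity) (hP 0)
          gcongr; linarith
        _ = _ := by ring
    · have e : iteratedFDeriv ℝ i (fun x : Rd d => χ (c • x) - 1) x =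
          c ^ i • iteratedFDeriv ℝ i χ (c • x) := by
        have h1 : (fun x : Rd d => χ (c • x) - 1) =
            (fun x : Rd d => χ (c • x)) - fun _ => (1 : ℂ) := rfl
        have h2 : ContDiffAt ℝ i (fun x : Rd d => χ (c • x)) x :=
          ((hχs.comp (contDiff_const_smul c)).of_le (mod_cast le_top)).contDiffAt
        rw [h1, iteratedFDeriv_sub_apply h2 contDiffAt_const,
          iteratedFDeriv_const_of_ne hi.ne',
          iteratedFDeriv_comp_const_smul (i := i) c (hχs.of_le (mod_cast le_top))]
        simp
      rw [e, norm_smul, norm_pow, Real.norm_of_nonneg hc.le]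
      have h2 := SchwartzMap.le_seminorm ℂ 0 i χ (c • x)
      rw [pow_zero, one_mul] at h2
      have h3 : c ^ i ≤ c := pow_le_of_le_one hc.le hc1 hi.ne'
      have h4 : SchwartzMap.seminorm ℂ 0 i χ ≤ P i := le_add_of_nonneg_right (apply_nonneg _ _)
      apply mul_le_mul h3 _ (norm_nonneg _) hc.le
      calc _ ≤ P i * 1 := by linarith
        _ ≤ _ := mul_le_mul_of_nonneg_left (by linarith [norm_nonneg x]) (hP i)
  refine SchwartzMap.seminorm_le_bound ℂ k l w (mul_nonneg hc.le hM) fun x => ?_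
  have ew : (w : Rd d → ℂ) = fun x => (χ (c • x) - 1) * θ x := funext hw
  rw [ew]
  have hmul := norm_iteratedFDeriv_mul_le (n := l) hWs (θ.smooth ⊤) x (mod_cast le_top)
  calc _ ≤ ‖x‖ ^ k * ∑ i ∈ Finset.range (l + 1), (l.choose i : ℝ) *
        ‖iteratedFDeriv ℝ i (fun x : Rd d => χ (c • x) - 1) x‖ *
          ‖iteratedFDeriv ℝ (l - i) θ x‖ := by gcongr
    _ ≤ c * M := by
      rw [Finset.mul_sum, Finset.mul_sum]
      refine Finset.sum_le_sum fun i _ => ?_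
      have h5 := SchwartzMap.le_seminorm ℂ k (l - i) θ x
      have h6 := SchwartzMap.le_seminorm ℂ (k + 1) (l - i) θ x
      calc _ ≤ ‖x‖ ^ k * ((l.choose i : ℝ) * (c * (P i * (1 + ‖x‖))) *
            ‖iteratedFDeriv ℝ (l - i) θ x‖) := by
            gcongr; exact hW i x
        _ = c * ((l.choose i : ℝ) * P i * (‖x‖ ^ k * ‖iteratedFDeriv ℝ (l - i) θ x‖ +
            ‖x‖ ^ (k + 1) * ‖iteratedFDeriv ℝ (l - i) θ x‖)) := by ring
        _ ≤ _ := by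
            have := hP i
            gcongr

/-- A continuous linear map on Schwartz functions that vanishes on all products vanishes. -/
lemma eq_zero_of_forall_pairing (L : 𝓢(Rd d, ℂ) →L[ℂ] E₂)
    (hL : ∀ a b : 𝓢(Rd d, ℂ), L (SchwartzMap.pairing (ContinuousLinearMap.mul ℂ ℂ) a b) = 0)
    (θ : 𝓢(Rd d, ℂ)) : L θ = 0 := by
  obtain ⟨χ, hχ⟩ : ∃ χ : 𝓢(Rd d, ℂ), χ 0 = 1 := by
    let b : ContDiffBump (0 : Rd d) := default
    have h1 : HasCompactSupport (Complex.ofRealCLM ∘ b) := b.hasCompactSupport.comp_left rfl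
    have h2 : ContDiff ℝ (⊤ : ℕ∞) (Complex.ofRealCLM ∘ b) :=
      Complex.ofRealCLM.contDiff.comp b.contDiff
    refine ⟨h1.toSchwartzMap h2, ?_⟩
    have h3 : b 0 = 1 := b.one_of_mem_closedBall (by simp [b.rIn_pos.le])
    simp [h3]
  have hc : ∀ n : ℕ, (0 : ℝ) < 1 / ((n : ℝ) + 1) := fun n => Nat.one_div_pos_of_nat
  let a : ℕ → 𝓢(Rd d, ℂ) := fun n => SchwartzMap.pairing (ContinuousLinearMap.mul ℂ ℂ)
    (SchwartzMap.compCLMOfContinuousLinearEquiv ℂ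
      (ContinuousLinearEquiv.smulLeft (Units.mk0 (1 / ((n : ℝ) + 1)) (hc n).ne')) χ) θ
  have ha : Filter.Tendsto a Filter.atTop (nhds θ) := by
    rw [(schwartz_withSeminorms ℂ (Rd d) ℂ).tendsto_nhds]
    rintro ⟨k, l⟩ ε hε
    obtain ⟨M, hM⟩ := seminorm_cutoff_le χ θ hχ k l
    have hlim : Filter.Tendsto (fun n : ℕ => 1 / ((n : ℝ) + 1) * M) Filter.atTop (nhds 0) := by
      simpa using tendsto_one_div_add_atTop_nhds_zero_nat.mul_const M
    filter_upwards [hlim.eventually_lt_const hε] with n hn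
    refine lt_of_le_of_lt (hM _ (hc n) ?_ (a n - θ) fun x => ?_) hn
    · rw [div_le_one (by positivity)]
      linarith [Nat.cast_nonneg (α := ℝ) n]
    · simp [a, sub_mul, Units.smul_def]
  have h0 : ∀ n, L (a n) = 0 := fun n => hL _ _
  have h1 := (L.continuous.tendsto θ).comp ha
  simp only [Function.comp_def, h0] at h1
  exact (tendsto_const_nhds_iff.mp h1).symm

lemma isConvolution_unique {B : E₀ →L[ℂ] E₁ →L[ℂ] E₂} {u : 𝓢'(Rd d, E₀)} {v : 𝓢'(Rd d, E₁)}
    {h h' : 𝓢'(Rd d, E₂)} (H : IsConvolution B u v h) (H' : IsConvolution B u v h') :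
    h = h' := by
  let L : 𝓢(Rd d, ℂ) →L[ℂ] E₂ := ((h - h' : 𝓢'(Rd d, E₂)) : 𝓢(Rd d, ℂ) →L[ℂ] E₂) ∘L
    (reflectAt 0 ∘L fourierInvCLM ℂ 𝓢(Rd d, ℂ))
  have hL : ∀ θ, L θ = 0 := by
    apply eq_zero_of_forall_pairing
    intro a b
    have e := (H (𝓕⁻ a) (𝓕⁻ b) 0).2.symm.trans (H' (𝓕⁻ a) (𝓕⁻ b) 0).2
    have e2 : schwartzConv (𝓕⁻ a) (𝓕⁻ b) =
        𝓕⁻ (SchwartzMap.pairing (ContinuousLinearMap.mul ℂ ℂ) a b) := by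
      simp [schwartzConv, SchwartzMap.convolution]
    rw [e2] at e
    exact sub_eq_zero.mpr e
  ext θ
  have := hL (𝓕 (reflectAt 0 θ))
  have e3 : reflectAt 0 (𝓕⁻ (𝓕 (reflectAt 0 θ))) = θ := by
    ext y; simp [reflectAt_apply]
  have e4 : (h - h') (reflectAt 0 (𝓕⁻ (𝓕 (reflectAt 0 θ)))) = 0 := this
  rw [e3] at e4
  exact sub_eq_zero.mp e4

lemma mem_fourierMultiplier_graph_iff {B : E₀ →L[ℂ] E₁ →L[ℂ] E₂} {μ : 𝓢'(Rd d, E₀)}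
    {f : 𝓢'(Rd d, E₁)} {h : 𝓢'(Rd d, E₂)} :
    (f, h) ∈ (fourierMultiplier B μ).graph ↔ IsConvolution B (𝓕⁻ μ) f h := by
  rw [fourierMultiplier, Submodule.toLinearPMap_graph_eq]
  · rfl
  · rintro ⟨v, h⟩ hx hv
    obtain rfl : v = 0 := hv
    exact isConvolution_unique hx (convolutionGraph B (𝓕⁻ μ)).zero_mem

end Convolution

end TimeFrequency

end

universe u₀ u₁ u₂

open TimeFrequency

/-!
Put `u = 𝓕⁻¹ μ`. Up to a unimodular factor, `V_g f (x, ξ)` is the smoothing of `f` by the modulated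
window `M_ξ g^*` at the point `x`, where `g^* y = conj (g (-y))`, and the Fourier transform
exchanges the two variables of the short-time Fourier transform. Hence the two norms are mixed
weighted norms of the amplitudes `|f * M_ξ γ| (x)` and `|u * M_ξ γ₀| (x)`, taken in the same order.

Convolution with the autocorrelation of `γ` reproduces a multiple of every smoothing, so amplitudes
for different windows dominate each other after convolution with a rapidly decreasing kernel.
By the inequalities of Minkowski, Young and Peetre, the norms then do not depend on the window, and
every smoothing is controlled by a continuous seminorm of its window.

If `h` is the convolution of `u` and `f`, then `h * M_ξ (φ * ψ) = (u * M_ξ φ) * (f * M_ξ ψ)`,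
because modulations distribute over convolutions. Young's inequality in `x` at fixed `ξ`, followed
by `⟨ξ⟩ ^ (s + δ) = ⟨ξ⟩ ^ s ⟨ξ⟩ ^ δ`, gives the estimate.

The convolution exists because `((u * φ) * (f * ψ)) (0)` is a continuous linear functional of
`φ * ψ`: resolve `φ` into the functions `φ * M_ξ (ρ * ρ^*)`, where `ξ ∈ ℝᵈ`, and move the factor
`φ * M_ξ ρ` over to `ψ`; only `φ * ψ` and the pairs `M_ξ ρ^*`, `M_ξ ρ` then appear.
-/

noncomputable section

namespace TimeFrequency

/-! ### Minkowski's integral inequality -/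

section Lp

variable {α β : Type*} [MeasurableSpace α] [MeasurableSpace β] {m : Measure α} {n : Measure β}

lemma eLpNorm_le_const_mul {f g : α → ℝ≥0∞} {c : ℝ≥0∞} (hg : Measurable g)
    (h : ∀ᵐ x ∂m, f x ≤ c * g x) (p : ℝ≥0∞) : eLpNorm f p m ≤ c * eLpNorm g p m := by
  rcases eq_or_ne c ∞ with rfl | hc
  · rcases eq_or_ne p 0 with rfl | hp
    · simp
    rcases eq_or_ne (eLpNorm g p m) 0 with h0 | h0
    · have hf : f =ᵐ[m] 0 := by
        filter_upwards [h, (eLpNorm_eq_zero_iff hg.aestronglyMeasurable hp).1 h0] with x hx hgx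
        simpa [hgx] using hx
      simp [eLpNorm_congr_ae hf]
    · simp [ENNReal.top_mul h0]
  · lift c to ℝ≥0 using hc
    exact eLpNorm_le_nnreal_smul_eLpNorm_of_ae_le_mul' h p

lemma ae_le_eLpNorm_top (a : α → ℝ≥0∞) : ∀ᵐ x ∂m, a x ≤ eLpNorm a ∞ m := by
  simpa only [eLpNorm_exponent_top, enorm_eq_self] using ae_le_eLpNormEssSup (f := a) (μ := m)

lemma eLpNorm_eq_lintegral_rpow {p : ℝ≥0∞} (hp : 1 ≤ p) (hp' : p ≠ ∞) (a : α → ℝ≥0∞) :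
    eLpNorm a p m = (∫⁻ x, a x ^ p.toReal ∂m) ^ (1 / p.toReal) := by
  simp only [eLpNorm_eq_lintegral_rpow_enorm_toReal (zero_lt_one.trans_le hp).ne' hp',
    enorm_eq_self]

lemma measurable_essSup_left [SFinite m] {b : α → β → ℝ≥0∞}
    (hb : Measurable (Function.uncurry b)) : Measurable fun ξ => essSup (fun y => b y ξ) m := by
  refine measurable_of_Iic fun c => ?_
  have hS : MeasurableSet {z : β × α | c < b z.2 z.1} :=
    measurableSet_lt measurable_const (hb.comp measurable_swap)
  convert! measurable_measure_prodMk_left (ν := m) hS (measurableSet_singleton 0) using 1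
  ext ξ
  have h_ae : m (Prod.mk ξ ⁻¹' {z : β × α | c < b z.2 z.1}) = 0 ↔ ∀ᵐ y ∂m, b y ξ ≤ c := by
    simp [ae_iff, Set.preimage]
  simp only [Set.mem_preimage, Set.mem_Iic, Set.mem_singleton_iff, h_ae]
  exact ⟨fun h => (ENNReal.ae_le_essSup (fun y => b y ξ)).mono fun _ hy => hy.trans h,
    fun h => essSup_le_of_ae_le c h⟩

lemma measurable_eLpNorm_left [SFinite m] {b : α → β → ℝ≥0∞}
    (hb : Measurable (Function.uncurry b)) (p : ℝ≥0∞) :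
    Measurable fun ξ => eLpNorm (fun y => b y ξ) p m := by
  rcases eq_or_ne p 0 with rfl | hp0
  · simp
  rcases eq_or_ne p ∞ with rfl | hpt
  · simpa only [eLpNorm_exponent_top, eLpNormEssSup, enorm_eq_self] using measurable_essSup_left hb
  · simp only [eLpNorm_eq_lintegral_rpow_enorm_toReal hp0 hpt, enorm_eq_self]
    exact (Measurable.lintegral_prod_left' (hb.pow_const p.toReal)).pow_const _

lemma lintegral_mul_le_eLpNorm_mul {a k : α → ℝ≥0∞} (ha : Measurable a) (hk : Measurable k)
    (hk_le : ∀ x, k x ≤ 1) {p : ℝ≥0∞} (hp : 1 ≤ p) :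
    ∫⁻ x, a x * k x ∂m ≤ eLpNorm a p m * (1 + ∫⁻ x, k x ∂m) := by
  rcases eq_or_ne p ∞ with rfl | hpt
  · calc ∫⁻ x, a x * k x ∂m ≤ ∫⁻ x, eLpNorm a ∞ m * k x ∂m := by
          refine lintegral_mono_ae ((ae_le_eLpNorm_top a).mono fun x hx => ?_)
          gcongr
      _ = eLpNorm a ∞ m * ∫⁻ x, k x ∂m := lintegral_const_mul _ hk
      _ ≤ _ := by gcongr; exact le_add_self
  rcases eq_or_lt_of_le hp with rfl | hp1
  · calc ∫⁻ x, a x * k x ∂m ≤ ∫⁻ x, a x * 1 ∂m := by gcongr with x; exact hk_le x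
      _ = eLpNorm a 1 m * 1 := by simp [eLpNorm_one_eq_lintegral_enorm]
      _ ≤ _ := by gcongr; exact le_self_add
  have hpq := Real.HolderConjugate.conjExponent
    (by simpa using (ENNReal.toReal_lt_toReal (by simp) hpt).2 hp1 : 1 < p.toReal)
  have hq : 1 < p.toReal.conjExponent := hpq.symm.lt
  rw [eLpNorm_eq_lintegral_rpow hp hpt]
  refine (ENNReal.lintegral_mul_le_Lp_mul_Lq m hpq ha.aemeasurable hk.aemeasurable).trans ?_
  gcongr
  calc (∫⁻ x, k x ^ p.toReal.conjExponent ∂m) ^ (1 / p.toReal.conjExponent)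
      ≤ (1 + ∫⁻ x, k x ∂m) ^ (1 / p.toReal.conjExponent) := by
        gcongr
        refine (lintegral_mono fun x => ?_).trans le_add_self
        simpa using ENNReal.rpow_le_rpow_of_exponent_ge (hk_le x) hq.le
    _ ≤ (1 + ∫⁻ x, k x ∂m) ^ (1 : ℝ) :=
        ENNReal.rpow_le_rpow_of_exponent_le le_self_add ((div_le_one (by linarith)).2 hq.le)
    _ = _ := ENNReal.rpow_one _

lemma exists_measurable_le_lt_lintegral_lt_top [SigmaFinite m] {F : α → ℝ≥0∞} {L : ℝ≥0∞}
    (hL : L < ∫⁻ x, F x ∂m) :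
    ∃ g : α → ℝ≥0∞, Measurable g ∧ g ≤ F ∧ ∫⁻ x, g x ∂m ≠ ∞ ∧ L < ∫⁻ x, g x ∂m := by
  simp_rw [lintegral_eq_nnreal, lt_iSup_iff, ← SimpleFunc.lintegral_eq_lintegral] at hL
  obtain ⟨f, hf, hL⟩ := hL
  obtain ⟨g, hgf, hg_fin, hg⟩ := SimpleFunc.exists_lt_lintegral_simpleFunc_of_lt_lintegral hL
  exact ⟨fun x => g x, g.measurable.coe_nnreal_ennreal,
    fun x => (ENNReal.coe_le_coe.2 (hgf x)).trans (hf x), hg_fin.ne, hg⟩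

section Minkowski

variable {b : α → β → ℝ≥0∞}

lemma lintegral_lintegral_mul_rpow_le [SFinite m] [SFinite n]
    (hb : Measurable (Function.uncurry b)) {P Q : ℝ} (hPQ : P.HolderConjugate Q) {g : α → ℝ≥0∞}
    (hg : Measurable g) :
    ∫⁻ y, (∫⁻ ξ, b y ξ ∂n) * g y ^ (1 / Q) ∂m ≤
      (∫⁻ ξ, (∫⁻ y, b y ξ ^ P ∂m) ^ (1 / P) ∂n) * (∫⁻ y, g y ∂m) ^ (1 / Q) := by
  have hbg : Measurable (Function.uncurry fun y ξ => b y ξ * g y ^ (1 / Q)) :=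
    hb.mul ((hg.comp measurable_fst).pow_const _)
  have hb_norm : Measurable fun ξ => (∫⁻ y, b y ξ ^ P ∂m) ^ (1 / P) :=
    (Measurable.lintegral_prod_left' (hb.pow_const P)).pow_const _
  calc ∫⁻ y, (∫⁻ ξ, b y ξ ∂n) * g y ^ (1 / Q) ∂m
      = ∫⁻ y, ∫⁻ ξ, b y ξ * g y ^ (1 / Q) ∂n ∂m :=
        lintegral_congr fun y => (lintegral_mul_const _ (hb.comp measurable_prodMk_left)).symm
    _ = ∫⁻ ξ, ∫⁻ y, b y ξ * g y ^ (1 / Q) ∂m ∂n := lintegral_lintegral_swap hbg.aemeasurable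
    _ ≤ ∫⁻ ξ, (∫⁻ y, b y ξ ^ P ∂m) ^ (1 / P) * (∫⁻ y, g y ∂m) ^ (1 / Q) ∂n := by
        refine lintegral_mono fun ξ => ?_
        have hbξ : Measurable fun y => b y ξ := hb.of_uncurry_right
        have h_holder := ENNReal.lintegral_mul_le_Lp_mul_Lq m hPQ hbξ.aemeasurable
          (hg.pow_const (1 / Q)).aemeasurable
        simpa only [← ENNReal.rpow_mul, one_div_mul_cancel hPQ.symm.ne_zero, ENNReal.rpow_one,
          Pi.mul_apply] using h_holder
    _ = _ := lintegral_mul_const _ hb_norm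

/- Testing the inner integral against `g ^ (1 / Q)` is Hölder's inequality; the finiteness of
`∫ g` allows one to cancel `(∫ g) ^ (1 / Q)` afterwards. -/
lemma lintegral_le_rpow_of_le_lintegral_rpow [SFinite m] [SFinite n]
    (hb : Measurable (Function.uncurry b)) {P Q : ℝ} (hPQ : P.HolderConjugate Q) {g : α → ℝ≥0∞}
    (hg : Measurable g) (hg_le : ∀ y, g y ≤ (∫⁻ ξ, b y ξ ∂n) ^ P) (hg_fin : ∫⁻ y, g y ∂m ≠ ∞) :
    ∫⁻ y, g y ∂m ≤ (∫⁻ ξ, (∫⁻ y, b y ξ ^ P ∂m) ^ (1 / P) ∂n) ^ P := by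
  have hP := hPQ.pos
  have hQ := hPQ.symm.pos
  have h_split : ∀ t : ℝ≥0∞, t = t ^ (1 / P) * t ^ (1 / Q) := fun t => by
    rw [← ENNReal.rpow_add_of_nonneg _ _ (by positivity) (by positivity), one_div, one_div,
      hPQ.inv_add_inv_eq_one, ENNReal.rpow_one]
  rcases eq_or_ne (∫⁻ y, g y ∂m) 0 with h0 | h0
  · simp [h0]
  have h_test : ∫⁻ y, g y ∂m ≤
      (∫⁻ ξ, (∫⁻ y, b y ξ ^ P ∂m) ^ (1 / P) ∂n) * (∫⁻ y, g y ∂m) ^ (1 / Q) := by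
    refine (lintegral_mono fun y => ?_).trans (lintegral_lintegral_mul_rpow_le hb hPQ hg)
    calc g y = g y ^ (1 / P) * g y ^ (1 / Q) := h_split _
      _ ≤ (∫⁻ ξ, b y ξ ∂n) * g y ^ (1 / Q) := by
          gcongr
          rw [one_div, ENNReal.rpow_inv_le_iff hP]
          exact hg_le y
  rw [← ENNReal.rpow_inv_le_iff hP, ← one_div]
  have h_ne_zero : (∫⁻ y, g y ∂m) ^ (1 / Q) ≠ 0 := by simp [ENNReal.rpow_eq_zero_iff, h0, hQ.le]
  have h_ne_top : (∫⁻ y, g y ∂m) ^ (1 / Q) ≠ ∞ := by finiteness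
  exact (ENNReal.mul_le_mul_iff_left h_ne_zero h_ne_top).1 ((h_split _).symm.le.trans h_test)

lemma eLpNorm_top_lintegral_le [SFinite m] [SFinite n] (hb : Measurable (Function.uncurry b)) :
    eLpNorm (fun y => ∫⁻ ξ, b y ξ ∂n) ∞ m ≤ ∫⁻ ξ, eLpNorm (fun y => b y ξ) ∞ m ∂n := by
  have h_set : MeasurableSet {z : α × β | b z.1 z.2 ≤ eLpNorm (fun y => b y z.2) ∞ m} :=
    measurableSet_le hb ((measurable_eLpNorm_left hb ∞).comp measurable_snd)
  have h_ae : ∀ᵐ y ∂m, ∀ᵐ ξ ∂n, b y ξ ≤ eLpNorm (fun y => b y ξ) ∞ m := by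
    rw [Measure.ae_ae_comm h_set]
    exact Filter.Eventually.of_forall fun ξ => ae_le_eLpNorm_top fun y => b y ξ
  rw [eLpNorm_exponent_top]
  exact eLpNormEssSup_le_of_ae_enorm_bound (h_ae.mono fun y hy => by
    simpa only [enorm_eq_self] using lintegral_mono_ae hy)

theorem eLpNorm_lintegral_le [SigmaFinite m] [SFinite n] (hb : Measurable (Function.uncurry b))
    {p : ℝ≥0∞} (hp : 1 ≤ p) :
    eLpNorm (fun y => ∫⁻ ξ, b y ξ ∂n) p m ≤ ∫⁻ ξ, eLpNorm (fun y => b y ξ) p m ∂n := by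
  rcases eq_or_ne p ∞ with rfl | hpt
  · exact eLpNorm_top_lintegral_le hb
  rcases eq_or_lt_of_le hp with rfl | hp1
  · simp only [eLpNorm_one_eq_lintegral_enorm, enorm_eq_self]
    exact (lintegral_lintegral_swap hb.aemeasurable).le
  have hPQ := Real.HolderConjugate.conjExponent
    (by simpa using (ENNReal.toReal_lt_toReal (by simp) hpt).2 hp1 : 1 < p.toReal)
  simp only [eLpNorm_eq_lintegral_rpow hp hpt]
  rw [one_div, ENNReal.rpow_inv_le_iff hPQ.pos, ← one_div]
  refine le_of_forall_lt fun L hL => ?_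
  obtain ⟨g, hg, hg_le, hg_fin, hLg⟩ := exists_measurable_le_lt_lintegral_lt_top hL
  exact hLg.trans_le (lintegral_le_rpow_of_le_lintegral_rpow hb hPQ hg hg_le hg_fin)

end Minkowski

end Lp

/-! ### Polynomial weights -/

section Weights

variable {d : ℕ}

lemma one_le_bracket (x : Rd d) : 1 ≤ bracket x := by
  rw [bracket, Real.one_le_sqrt]
  nlinarith [sq_nonneg ‖x‖]

lemma bracket_pos (x : Rd d) : 0 < bracket x := zero_lt_one.trans_le (one_le_bracket x)

lemma bracket_le_one_add_norm (x : Rd d) : bracket x ≤ 1 + ‖x‖ := sqrt_one_add_norm_sq_le x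

lemma continuous_bracket : Continuous (bracket : Rd d → ℝ) := by
  unfold bracket; fun_prop

lemma bracket_neg (x : Rd d) : bracket (-x) = bracket x := by simp [bracket]

lemma bracket_add_le (x y : Rd d) : bracket (x + y) ≤ 2 * bracket x * bracket y := by
  have hx : bracket x ^ 2 = 1 + ‖x‖ ^ 2 := Real.sq_sqrt (by positivity)
  have hy : bracket y ^ 2 = 1 + ‖y‖ ^ 2 := Real.sq_sqrt (by positivity)
  have hx_pos := bracket_pos x
  have hy_pos := bracket_pos y
  rw [bracket, Real.sqrt_le_left (by positivity), mul_pow, mul_pow, hx, hy]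
  have h_norm : ‖x + y‖ ^ 2 ≤ (‖x‖ + ‖y‖) ^ 2 := by gcongr; exact norm_add_le x y
  nlinarith [sq_nonneg (‖x‖ - ‖y‖), sq_nonneg (‖x‖ * ‖y‖), sq_nonneg ‖x‖, sq_nonneg ‖y‖]

/-- The weight `⟨x⟩ ^ r`, with values in `[0, ∞]`. -/
def weight (r : ℝ) (x : Rd d) : ℝ≥0∞ := ENNReal.ofReal (bracket x ^ r)

lemma measurable_weight (r : ℝ) : Measurable (weight r : Rd d → ℝ≥0∞) :=
  (continuous_bracket.measurable.pow_const r).ennreal_ofReal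

lemma weight_add_exponent (r s : ℝ) (x : Rd d) :
    weight (r + s) x = weight r x * weight s x := by
  rw [weight, weight, weight, ← ENNReal.ofReal_mul (Real.rpow_nonneg (bracket_pos x).le _),
    Real.rpow_add (bracket_pos x)]

lemma weight_zero (x : Rd d) : weight 0 x = 1 := by simp [weight]

lemma weight_apply_zero (r : ℝ) : weight r (0 : Rd d) = 1 := by simp [weight, bracket]

lemma weight_neg (r : ℝ) (x : Rd d) : weight r (-x) = weight r x := by simp [weight, bracket_neg]

lemma weight_ne_top (r : ℝ) (x : Rd d) : weight r x ≠ ∞ := ENNReal.ofReal_ne_top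

lemma weight_mul_weight_neg_exponent (r : ℝ) (x : Rd d) : weight r x * weight (-r) x = 1 := by
  rw [← weight_add_exponent, add_neg_cancel, weight_zero]

lemma weight_neg_sub_exponent (r s : ℝ) (x : Rd d) :
    weight (-(s - r)) x = weight r x * weight (-s) x := by
  rw [neg_sub, sub_eq_add_neg, weight_add_exponent]

lemma weight_mono {r s : ℝ} (h : r ≤ s) (x : Rd d) : weight r x ≤ weight s x :=
  ENNReal.ofReal_le_ofReal (Real.rpow_le_rpow_of_exponent_le (one_le_bracket x) h)

lemma weight_le_iff_le_weight_neg_mul {r : ℝ} {x : Rd d} {a b : ℝ≥0∞} :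
    weight r x * a ≤ b ↔ a ≤ b * weight (-r) x := by
  have h_inv := weight_mul_weight_neg_exponent r x
  constructor <;> intro h
  · calc a = weight r x * a * weight (-r) x := by rw [mul_right_comm, h_inv, one_mul]
      _ ≤ b * weight (-r) x := by gcongr
  · calc weight r x * a ≤ weight r x * (b * weight (-r) x) := by gcongr
      _ = b := by rw [mul_left_comm, h_inv, mul_one]

lemma weight_add_le_of_nonneg {r : ℝ} (hr : 0 ≤ r) (x y : Rd d) :
    weight r (x + y) ≤ ENNReal.ofReal (2 ^ r) * (weight r x * weight r y) := by
  have hx := (bracket_pos x).le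
  have hy := (bracket_pos y).le
  rw [weight, weight, weight, ← ENNReal.ofReal_mul (by positivity),
    ← ENNReal.ofReal_mul (by positivity), ← Real.mul_rpow hx hy,
    ← Real.mul_rpow zero_le_two (by positivity), ← mul_assoc]
  exact ENNReal.ofReal_le_ofReal
    (Real.rpow_le_rpow (bracket_pos _).le (bracket_add_le x y) hr)

/- Peetre's inequality: for negative `r`, apply the case of `-r` to `x = (x + y) + (-y)`. -/
lemma weight_add_le (r : ℝ) (x y : Rd d) :
    weight r (x + y) ≤ ENNReal.ofReal (2 ^ |r|) * (weight r x * weight |r| y) := by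
  rcases le_total 0 r with hr | hr
  · simpa only [abs_of_nonneg hr] using weight_add_le_of_nonneg hr x y
  have h := weight_add_le_of_nonneg (neg_nonneg.2 hr) (x + y) (-y)
  rw [add_neg_cancel_right, weight_neg, ← mul_one (weight (-r) x),
    weight_le_iff_le_weight_neg_mul, neg_neg] at h
  rw [abs_of_nonpos hr, ← mul_one (weight r (x + y)), weight_le_iff_le_weight_neg_mul]
  calc (1 : ℝ≥0∞) ≤ _ := h
    _ = _ := by ring

lemma lintegral_weight_neg_ne_top {r : ℝ} (hr : (d : ℝ) < r) :
    ∫⁻ x : Rd d, weight (-r) x ≠ ∞ := by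
  have h := integrable_rpow_neg_one_add_norm_sq (E := Rd d) (μ := volume) (r := r)
    (by simpa using hr)
  have h_eq : ∀ x : Rd d, weight (-r) x = ENNReal.ofReal ((1 + ‖x‖ ^ 2) ^ (-r / 2)) := fun x => by
    rw [weight, bracket, Real.sqrt_eq_rpow, ← Real.rpow_mul (by positivity)]
    ring_nf
  simp_rw [h_eq]
  exact h.lintegral_lt_top.ne

end Weights

/-! ### Mixed weighted norms and convolution with a rapidly decreasing kernel -/

section WeightedNorms

variable {d : ℕ}

/-- The `L^p_r` norm of a function with values in `[0, ∞]`. -/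
def weightedNorm (p : ℝ≥0∞) (r : ℝ) (a : Rd d → ℝ≥0∞) : ℝ≥0∞ :=
  eLpNorm (fun x => weight r x * a x) p volume

/-- The mixed weighted norm of a function on `ℝᵈ × ℝᵈ`: the `L^p_r` norm in the first variable,
followed by the `L^q_s` norm in the second. -/
def mixedNorm (p q : ℝ≥0∞) (r s : ℝ) (Φ : Rd d → Rd d → ℝ≥0∞) : ℝ≥0∞ :=
  weightedNorm q s fun ξ => weightedNorm p r fun x => Φ x ξ

/-- The convolution of `a` with the kernel `⟨z⟩ ^ (-M)`. -/
def smear (M : ℝ) (a : Rd d → ℝ≥0∞) (x : Rd d) : ℝ≥0∞ := ∫⁻ z, a (x - z) * weight (-M) z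

/-- `Ψ` is dominated by `c` times the convolution of `Φ`, in both variables, with the kernel
`⟨z⟩ ^ (-M)`. -/
def ConvDominated (c : ℝ≥0) (M : ℝ) (Φ Ψ : Rd d → Rd d → ℝ≥0∞) : Prop :=
  ∀ x η, Ψ x η ≤ c * smear M (fun ξ => smear M (fun y => Φ y ξ) x) η

variable {p q : ℝ≥0∞} {r s M : ℝ} {a : Rd d → ℝ≥0∞} {Φ Ψ : Rd d → Rd d → ℝ≥0∞}

lemma weightedNorm_le_const_mul {a b : Rd d → ℝ≥0∞} {c : ℝ≥0∞} (hb : Measurable b)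
    (h : ∀ᵐ x, a x ≤ c * b x) (p : ℝ≥0∞) (r : ℝ) :
    weightedNorm p r a ≤ c * weightedNorm p r b := by
  refine eLpNorm_le_const_mul ((measurable_weight r).mul hb) (h.mono fun x hx => ?_) p
  grw [hx, mul_left_comm]
  rfl

lemma measurable_weightedNorm_left (hΦ : Measurable (Function.uncurry Φ)) (p : ℝ≥0∞) (r : ℝ) :
    Measurable fun ξ => weightedNorm p r fun x => Φ x ξ :=
  measurable_eLpNorm_left (((measurable_weight r).comp measurable_fst).mul hΦ) p

lemma weightedNorm_one (r : ℝ) (a : Rd d → ℝ≥0∞) :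
    weightedNorm 1 r a = ∫⁻ x, weight r x * a x := by
  simp only [weightedNorm, eLpNorm_one_eq_lintegral_enorm, enorm_eq_self]

lemma weight_mul_lintegral_sub_mul_le (r : ℝ) (a k : Rd d → ℝ≥0∞) (x : Rd d) :
    weight r x * ∫⁻ z, a (x - z) * k z ≤
      ENNReal.ofReal (2 ^ |r|) * ∫⁻ z, weight r (x - z) * a (x - z) * (weight |r| z * k z) := by
  rw [← lintegral_const_mul' _ _ (weight_ne_top r x), ← lintegral_const_mul' _ _ (by finiteness)]
  refine lintegral_mono fun z => ?_
  have h_peetre := weight_add_le r (x - z) z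
  rw [sub_add_cancel] at h_peetre
  calc _ ≤ (ENNReal.ofReal (2 ^ |r|) * (weight r (x - z) * weight |r| z)) * (a (x - z) * k z) := by
        gcongr
    _ = _ := by ring

lemma measurable_lintegral_sub_mul {k : Rd d → ℝ≥0∞} (ha : Measurable a) (hk : Measurable k) :
    Measurable fun x => ∫⁻ z, a (x - z) * k z :=
  Measurable.lintegral_prod_right'
    ((ha.comp (measurable_fst.sub measurable_snd)).mul (hk.comp measurable_snd))

lemma eLpNorm_lintegral_sub_mul_le (hp : 1 ≤ p) {k : Rd d → ℝ≥0∞} (ha : Measurable a)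
    (hk : Measurable k) :
    eLpNorm (fun x => ∫⁻ z, a (x - z) * k z) p volume ≤ (∫⁻ z, k z) * eLpNorm a p volume := by
  have h_meas : Measurable (Function.uncurry fun x z : Rd d => a (x - z) * k z) :=
    (ha.comp (measurable_fst.sub measurable_snd)).mul (hk.comp measurable_snd)
  refine (eLpNorm_lintegral_le h_meas hp).trans ?_
  rw [← lintegral_mul_const _ hk]
  refine lintegral_mono fun z => ?_
  rw [← eLpNorm_comp_measurePreserving ha.aestronglyMeasurable
    (measurePreserving_sub_right volume z)]
  exact eLpNorm_le_const_mul (ha.comp (measurable_sub_const z))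
    (.of_forall fun x => (mul_comm _ _).le) p

lemma weightedNorm_lintegral_sub_mul_le (hp : 1 ≤ p) (r : ℝ) {k : Rd d → ℝ≥0∞}
    (ha : Measurable a) (hk : Measurable k) :
    weightedNorm p r (fun x => ∫⁻ z, a (x - z) * k z) ≤
      ENNReal.ofReal (2 ^ |r|) * (weightedNorm 1 |r| k * weightedNorm p r a) := by
  have hwa : Measurable fun y => weight r y * a y := (measurable_weight r).mul ha
  have hwk : Measurable fun z => weight |r| z * k z := (measurable_weight |r|).mul hk
  rw [weightedNorm_one]
  refine (eLpNorm_le_const_mul (measurable_lintegral_sub_mul hwa hwk)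
    (.of_forall (weight_mul_lintegral_sub_mul_le r a k)) p).trans ?_
  gcongr
  exact eLpNorm_lintegral_sub_mul_le (a := fun y => weight r y * a y) hp hwa hwk

lemma measurable_uncurry_smear (hΦ : Measurable (Function.uncurry Φ)) (M : ℝ) :
    Measurable (Function.uncurry fun x ξ => smear M (fun y => Φ y ξ) x) := by
  refine Measurable.lintegral_prod_right' (f := fun z : (Rd d × Rd d) × Rd d =>
    Φ (z.1.1 - z.2) z.1.2 * weight (-M) z.2) (.mul ?_ ((measurable_weight _).comp measurable_snd))
  exact hΦ.comp (f := fun z : (Rd d × Rd d) × Rd d => (z.1.1 - z.2, z.1.2)) (by fun_prop)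

lemma measurable_smear (ha : Measurable a) (M : ℝ) : Measurable (smear M a) :=
  measurable_lintegral_sub_mul ha (measurable_weight (-M))

lemma smear_mono {a b : Rd d → ℝ≥0∞} (h : ∀ x, a x ≤ b x) (M : ℝ) (x : Rd d) :
    smear M a x ≤ smear M b x :=
  lintegral_mono fun z => mul_le_mul_left (h (x - z)) _

lemma smear_const_mul {c : ℝ≥0∞} (hc : c ≠ ∞) (M : ℝ) (a : Rd d → ℝ≥0∞) (x : Rd d) :
    smear M (fun y => c * a y) x = c * smear M a x := by
  simp only [smear, mul_assoc, lintegral_const_mul' _ _ hc]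

lemma smear_le_eLpNorm_mul (hp : 1 ≤ p) (hM : 0 ≤ M) (ha : Measurable a) (x : Rd d) :
    smear M a x ≤ (1 + ∫⁻ z : Rd d, weight (-M) z) * eLpNorm a p volume := by
  have h_holder := lintegral_mul_le_eLpNorm_mul (m := volume) (a := fun z => a (x - z))
    (ha.comp (by fun_prop)) (measurable_weight (-M))
    (fun z => (weight_mono (neg_nonpos.2 hM) z).trans_eq (weight_zero z)) hp
  rwa [mul_comm, ← eLpNorm_comp_measurePreserving ha.aestronglyMeasurable
    (Measure.measurePreserving_sub_left volume x)]

lemma weight_mul_smear_le (r M : ℝ) (a : Rd d → ℝ≥0∞) (x : Rd d) :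
    weight r x * smear M a x ≤
      ENNReal.ofReal (2 ^ |r|) * smear (M - |r|) (fun y => weight r y * a y) x := by
  refine (weight_mul_lintegral_sub_mul_le r a (weight (-M)) x).trans_eq ?_
  simp only [smear, weight_neg_sub_exponent]

lemma exists_weighted_smear_le (hM : d + |r| < M) :
    ∃ C : ℝ≥0, ∀ {p : ℝ≥0∞} {a : Rd d → ℝ≥0∞}, 1 ≤ p → Measurable a →
      (∀ x, weight r x * smear M a x ≤ C * weightedNorm p r a) ∧
      weightedNorm p r (smear M a) ≤ C * weightedNorm p r a := by
  have h_int : ∫⁻ z : Rd d, weight (-(M - |r|)) z ≠ ∞ := lintegral_weight_neg_ne_top (by linarith)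
  have h_nonneg : 0 ≤ M - |r| := by linarith [Nat.cast_nonneg (α := ℝ) d]
  set I := ∫⁻ z : Rd d, weight (-(M - |r|)) z
  refine ⟨(ENNReal.ofReal (2 ^ |r|) * (1 + I)).toNNReal, fun {p a} hp ha => ?_⟩
  rw [ENNReal.coe_toNNReal (by finiteness), mul_assoc]
  have hwa : Measurable fun x => weight r x * a x := (measurable_weight r).mul ha
  constructor
  · intro x
    grw [weight_mul_smear_le, smear_le_eLpNorm_mul hp h_nonneg hwa]
    rfl
  · have kernel_norm : weightedNorm 1 |r| (weight (-M) : Rd d → ℝ≥0∞) = I := by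
      rw [weightedNorm_one]
      simp only [I, weight_neg_sub_exponent]
    refine (weightedNorm_lintegral_sub_mul_le hp r ha (measurable_weight _)).trans ?_
    rw [kernel_norm]
    gcongr
    exact le_add_self

lemma weightedNorm_smear_le (hp : 1 ≤ p) (hΦ : Measurable (Function.uncurry Φ)) (r M : ℝ)
    (η : Rd d) : weightedNorm p r (fun x => smear M (Φ x) η) ≤
      smear M (fun ξ => weightedNorm p r fun x => Φ x ξ) η := by
  have h_meas : Measurable (Function.uncurry fun x ξ : Rd d =>
      weight (-M) ξ * (weight r x * Φ x (η - ξ))) :=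
    ((measurable_weight _).comp measurable_snd).mul (((measurable_weight r).comp measurable_fst).mul
      (hΦ.comp (measurable_fst.prodMk (measurable_snd.const_sub η))))
  calc weightedNorm p r (fun x => smear M (Φ x) η)
      = eLpNorm (fun x => ∫⁻ ξ, weight (-M) ξ * (weight r x * Φ x (η - ξ))) p volume := by
        simp only [weightedNorm, smear, ← lintegral_const_mul' _ _ (weight_ne_top r _)]
        congr! 4
        ring
    _ ≤ ∫⁻ ξ, eLpNorm (fun x => weight (-M) ξ * (weight r x * Φ x (η - ξ))) p volume :=
        eLpNorm_lintegral_le h_meas hp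
    _ ≤ smear M (fun ξ => weightedNorm p r fun x => Φ x ξ) η := by
        refine lintegral_mono fun ξ => ?_
        rw [mul_comm]
        exact eLpNorm_le_const_mul ((measurable_weight r).mul hΦ.of_uncurry_right)
          (.of_forall fun x => le_rfl) p

namespace ConvDominated

lemma exists_slice_le (hM : d + |r| < M) :
    ∃ C : ℝ≥0, ∀ {p : ℝ≥0∞} {c : ℝ≥0} {Φ Ψ : Rd d → Rd d → ℝ≥0∞}, 1 ≤ p →
      Measurable (Function.uncurry Φ) → ConvDominated c M Φ Ψ → ∀ η,
      (∀ x, weight r x * Ψ x η ≤ C * c * smear M (fun ξ => weightedNorm p r fun x => Φ x ξ) η) ∧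
      weightedNorm p r (fun x => Ψ x η) ≤
        C * c * smear M (fun ξ => weightedNorm p r fun x => Φ x ξ) η := by
  obtain ⟨C, hC⟩ := exists_weighted_smear_le (d := d) hM
  refine ⟨C, fun {p c Φ Ψ} hp hΦ h η => ?_⟩
  have hΦξ : ∀ ξ, Measurable fun x => Φ x ξ := fun ξ => hΦ.of_uncurry_right
  have h_meas : Measurable (Function.uncurry fun η x =>
      smear M (fun ξ => smear M (fun y => Φ y ξ) x) η) :=
    measurable_uncurry_smear (Φ := fun ξ x => smear M (fun y => Φ y ξ) x)
      ((measurable_uncurry_smear hΦ M).comp measurable_swap) M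
  rw [mul_comm (C : ℝ≥0∞), mul_assoc, ← smear_const_mul ENNReal.coe_ne_top]
  constructor
  · intro x
    grw [h x η, mul_left_comm, ← smear_const_mul (weight_ne_top r x)]
    gcongr
    exact smear_mono (fun ξ => (hC hp (hΦξ ξ)).1 x) M η
  · calc weightedNorm p r (fun x => Ψ x η)
        ≤ c * weightedNorm p r (fun x => smear M (fun ξ => smear M (fun y => Φ y ξ) x) η) :=
          weightedNorm_le_const_mul h_meas.of_uncurry_left (.of_forall (h · η)) p r
      _ ≤ c * smear M (fun ξ => weightedNorm p r (smear M fun y => Φ y ξ)) η := by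
          gcongr
          exact weightedNorm_smear_le hp (measurable_uncurry_smear hΦ M) r M η
      _ ≤ _ := by
          gcongr
          exact smear_mono (fun ξ => (hC hp (hΦξ ξ)).2) M η

lemma exists_mixedNorm_le (hMr : d + |r| < M) (hMs : d + |s| < M) :
    ∃ C : ℝ≥0, ∀ {p q : ℝ≥0∞} {c : ℝ≥0} {Φ Ψ : Rd d → Rd d → ℝ≥0∞}, 1 ≤ p → 1 ≤ q →
      Measurable (Function.uncurry Φ) → ConvDominated c M Φ Ψ →
      (∀ x η, weight s η * (weight r x * Ψ x η) ≤ C * c * mixedNorm p q r s Φ) ∧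
      (∀ η, weight s η * weightedNorm p r (fun x => Ψ x η) ≤ C * c * mixedNorm p q r s Φ) ∧
      mixedNorm p q r s Ψ ≤ C * c * mixedNorm p q r s Φ := by
  obtain ⟨C, hC⟩ := exists_slice_le (d := d) hMr
  obtain ⟨C', hC'⟩ := exists_weighted_smear_le (d := d) hMs
  refine ⟨C' * C, fun {p q c Φ Ψ} hp hq hΦ h => ?_⟩
  have h_outer := hC' hq (measurable_weightedNorm_left hΦ p r)
  have h_assoc : ((C' * C : ℝ≥0) : ℝ≥0∞) * c * mixedNorm p q r s Φ =
      C * c * (C' * mixedNorm p q r s Φ) := by rw [ENNReal.coe_mul]; ring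
  have h_slice : ∀ {t : ℝ≥0∞} {η : Rd d},
      t ≤ C * c * smear M (fun ξ => weightedNorm p r fun x => Φ x ξ) η →
      weight s η * t ≤ C * c * (C' * mixedNorm p q r s Φ) := fun {t η} ht => by
    grw [ht, mul_left_comm]
    exact mul_le_mul' le_rfl (h_outer.1 η)
  rw [h_assoc]
  refine ⟨fun x η => h_slice ((hC hp hΦ h η).1 x), fun η => h_slice (hC hp hΦ h η).2, ?_⟩
  calc mixedNorm p q r s Ψ
      ≤ C * c * weightedNorm q s (smear M fun ξ => weightedNorm p r fun x => Φ x ξ) :=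
        weightedNorm_le_const_mul (measurable_smear (measurable_weightedNorm_left hΦ p r) M)
          (.of_forall fun η => (hC hp hΦ h η).2) q s
    _ ≤ _ := by gcongr; exact h_outer.2

end ConvDominated

end WeightedNorms

/-! ### Integrals of curves of Schwartz functions -/

section SchwartzIntegral

open BoundedContinuousFunction LineDeriv

lemma exists_strongDual_comp_eq {F G : Type*} [AddCommGroup F] [Module ℂ F]
    [NormedAddCommGroup G] [NormedSpace ℂ G] (J : F →ₗ[ℂ] G) (T : F →ₗ[ℂ] ℂ) {C : ℝ}
    (hT : ∀ v, ‖T v‖ ≤ C * ‖J v‖) : ∃ ℓ : StrongDual ℂ G, ∀ v, ℓ (J v) = T v := by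
  obtain ⟨S, hS⟩ := J.rangeRestrict.exists_rightInverse_of_surjective J.range_rangeRestrict
  have hJS (w : LinearMap.range J) : J (S w) = w :=
    congrArg Subtype.val (LinearMap.congr_fun hS w)
  let ℓ₀ : StrongDual ℂ (LinearMap.range J) :=
    (T ∘ₗ S).mkContinuous C fun w => (hT (S w)).trans_eq (by rw [hJS]; rfl)
  obtain ⟨ℓ, hℓ, -⟩ := exists_extension_norm_eq _ ℓ₀
  refine ⟨ℓ, fun v => (hℓ (J.rangeRestrict v)).trans ?_⟩
  have hker := hT (S (J.rangeRestrict v) - v)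
  rw [map_sub J, hJS, LinearMap.codRestrict_apply, sub_self, norm_zero, mul_zero,
    norm_le_zero_iff, map_sub] at hker
  exact sub_eq_zero.1 hker

variable {V : Type*} [NormedAddCommGroup V] [NormedSpace ℝ V]

/-- The bounded functions `V → V [×l]→L[ℝ] ℂ`, with the metric of the codomain spelled out: instance
search does not unify `ContinuousMultilinearMap.instPseudoMetricSpace` with the metric induced by
`ContinuousMultilinearMap.normedAddCommGroup`. -/
abbrev BoundedForms (V : Type*) [NormedAddCommGroup V] [NormedSpace ℝ V] (l : ℕ) : Type _ :=
  @BoundedContinuousFunction V (V [×l]→L[ℝ] ℂ) _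
    NormedAddCommGroup.toSeminormedAddCommGroup.toPseudoMetricSpace

/-- The bounded function `x ↦ ‖x‖ ^ k • D^l φ x`, whose supremum norm is a Schwartz seminorm
of `φ`. -/
def weightedDerivCLM (k l : ℕ) : 𝓢(V, ℂ) →L[ℂ] BoundedForms V l :=
  SchwartzMap.mkCLMtoNormedSpace
    (fun φ : 𝓢(V, ℂ) => BoundedContinuousFunction.ofNormedAddCommGroup
      (fun x : V => ‖x‖ ^ k • iteratedFDeriv ℝ l φ x)
      ((continuous_norm.pow k).smul ((φ.smooth l).continuous_iteratedFDeriv le_rfl))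
      (SchwartzMap.seminorm ℂ k l φ)
      fun x => by simpa [norm_smul] using SchwartzMap.le_seminorm ℂ k l φ x)
    (fun φ ψ => by
      ext1 x
      simp [iteratedFDeriv_add_apply (φ.smooth l).contDiffAt (ψ.smooth l).contDiffAt])
    (fun c φ => by
      ext1 x
      simpa [iteratedFDeriv_const_smul_apply (φ.smooth l).contDiffAt] using smul_comm _ c _)
    ⟨{(k, l)}, 1, zero_le_one, fun φ => by
      simpa [schwartzSeminormFamily] using
        BoundedContinuousFunction.norm_ofNormedAddCommGroup_le _ (apply_nonneg _ _) _⟩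

lemma weightedDerivCLM_apply (k l : ℕ) (φ : 𝓢(V, ℂ)) (x : V) :
    weightedDerivCLM k l φ x = ‖x‖ ^ k • iteratedFDeriv ℝ l φ x := rfl

lemma seminorm_le_norm_weightedDerivCLM (k l : ℕ) (φ : 𝓢(V, ℂ)) :
    SchwartzMap.seminorm ℂ k l φ ≤ ‖weightedDerivCLM k l φ‖ :=
  SchwartzMap.seminorm_le_bound ℂ k l φ (norm_nonneg _) fun x => by
    simpa [weightedDerivCLM_apply, norm_smul] using (weightedDerivCLM k l φ).norm_coe_le_norm x

lemma continuous_seminorm (k l : ℕ) :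
    Continuous (SchwartzMap.seminorm ℂ k l : Seminorm ℂ 𝓢(V, ℂ)) :=
  (schwartz_withSeminorms ℂ V ℂ).continuous_seminorm (k, l)

/-- The evaluation of Schwartz functions at a point, as a continuous linear map. -/
def evalAtCLM (y : V) : 𝓢(V, ℂ) →L[ℂ] ℂ :=
  (BoundedContinuousFunction.evalCLM ℂ y).comp (SchwartzMap.toBoundedContinuousFunctionCLM ℂ V ℂ)

variable {X : Type*} [TopologicalSpace X] [MeasurableSpace X] {m : Measure X}
  {Φ : X → 𝓢(V, ℂ)} {θ : 𝓢(V, ℂ)}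

/-- The Schwartz function `θ` is the integral of the continuous curve `Φ`, which converges
absolutely with respect to every Schwartz seminorm. The integral is taken pointwise, since the
Bochner integral is only available for curves in normed spaces. -/
structure IsSchwartzIntegral (m : Measure X) (Φ : X → 𝓢(V, ℂ)) (θ : 𝓢(V, ℂ)) : Prop where
  continuous : Continuous Φ
  integrable_seminorm : ∀ k l, Integrable (fun x => SchwartzMap.seminorm ℂ k l (Φ x)) m
  eq_integral : ∀ y, θ y = ∫ x, Φ x y ∂m

namespace IsSchwartzIntegral

variable [OpensMeasurableSpace X]

lemma integrable_of_continuous_seminorm (h : IsSchwartzIntegral m Φ θ)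
    {q : Seminorm ℂ 𝓢(V, ℂ)} (hq : Continuous q) : Integrable (fun x => q (Φ x)) m := by
  obtain ⟨s, C, -, hC⟩ := Seminorm.bound_of_continuous (schwartz_withSeminorms ℂ V ℂ) q hq
  refine ((integrable_finsetSum s fun i _ => h.integrable_seminorm i.1 i.2).const_mul
    (C : ℝ)).mono' (hq.comp h.continuous).aestronglyMeasurable (.of_forall fun x => ?_)
  rw [Real.norm_of_nonneg (apply_nonneg _ _)]
  have seminorm_nonneg (i : ℕ × ℕ) : 0 ≤ SchwartzMap.seminorm ℂ i.1 i.2 (Φ x) := apply_nonneg _ _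
  refine (hC (Φ x)).trans (mul_le_mul_of_nonneg_left (Seminorm.finset_sup_apply_le
    (Finset.sum_nonneg fun i _ => seminorm_nonneg i) fun i hi => ?_) C.2)
  exact Finset.single_le_sum (fun i _ => seminorm_nonneg i) hi

lemma integrable_seminorm_map (h : IsSchwartzIntegral m Φ θ) (T : 𝓢(V, ℂ) →L[ℂ] 𝓢(V, ℂ))
    (k l : ℕ) : Integrable (fun x => SchwartzMap.seminorm ℂ k l (T (Φ x))) m := by
  have hq : Continuous ((SchwartzMap.seminorm ℂ k l).comp T.toLinearMap : Seminorm ℂ 𝓢(V, ℂ)) :=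
    (continuous_seminorm k l).comp T.continuous
  exact h.integrable_of_continuous_seminorm hq

variable [SecondCountableTopology X] {E : Type*} [NormedAddCommGroup E] [NormedSpace ℂ E]

lemma integrable_map (h : IsSchwartzIntegral m Φ θ) (L : 𝓢(V, ℂ) →L[ℂ] E) :
    Integrable (fun x => L (Φ x)) m :=
  (h.integrable_of_continuous_seminorm (q := (normSeminorm ℂ E).comp L.toLinearMap)
    (continuous_norm.comp L.continuous)).mono'
    (L.continuous.comp h.continuous).aestronglyMeasurable (.of_forall fun _ => le_rfl)

lemma lineDerivOp (h : IsSchwartzIntegral m Φ θ) (v : V) :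
    IsSchwartzIntegral m (fun x => ∂_{v} (Φ x)) (∂_{v} θ) := by
  let D := lineDerivOpCLM ℂ 𝓢(V, ℂ) v
  refine ⟨D.continuous.comp h.continuous, h.integrable_seminorm_map D, fun y => ?_⟩
  have hasDerivAt_line (φ : 𝓢(V, ℂ)) (t : ℝ) :
      HasDerivAt (fun t : ℝ => φ (y + t • v)) ((∂_{v} φ) (y + t • v)) t := by
    have hline : HasDerivAt (fun t : ℝ => y + t • v) v t := by
      simpa using ((hasDerivAt_id t).smul_const v).const_add y
    exact (φ.hasFDerivAt (y + t • v)).comp_hasDerivAt t hline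
  have hasDerivAt_integral := (hasDerivAt_integral_of_dominated_loc_of_deriv_le (μ := m) (𝕜 := ℝ)
    (F := fun t x => Φ x (y + t • v)) (F' := fun t x => (∂_{v} (Φ x)) (y + t • v)) (x₀ := 0)
    (s := Set.univ) Filter.univ_mem
    (.of_forall fun t => (h.integrable_map (evalAtCLM (y + t • v))).1)
    (h.integrable_map (evalAtCLM (y + (0 : ℝ) • v)))
    (h.integrable_map (evalAtCLM (y + (0 : ℝ) • v) ∘L D)).1
    (.of_forall fun x t _ => SchwartzMap.norm_le_seminorm ℂ _ _) (h.integrable_seminorm_map D 0 0)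
    (.of_forall fun x t _ => hasDerivAt_line (Φ x) t)).2
  have hasDerivAt_θ := hasDerivAt_line θ 0
  simp only [funext h.eq_integral] at hasDerivAt_θ
  simpa using hasDerivAt_θ.unique hasDerivAt_integral

lemma iteratedLineDerivOp {l : ℕ} (v : Fin l → V) (h : IsSchwartzIntegral m Φ θ) :
    IsSchwartzIntegral m (fun x => ∂^{v} (Φ x)) (∂^{v} θ) := by
  induction l generalizing Φ θ with
  | zero => simpa using h
  | succ l ih =>
    simp only [iteratedLineDerivOp_succ_right]
    exact ih _ (h.lineDerivOp (v (Fin.last l)))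

lemma weightedDerivCLM_eq_integral (h : IsSchwartzIntegral m Φ θ) (k l : ℕ) :
    weightedDerivCLM k l θ = ∫ x, weightedDerivCLM k l (Φ x) ∂m := by
  ext z v
  let ev := (ContinuousMultilinearMap.apply ℝ (fun _ : Fin l => V) ℂ v).comp
    (BoundedContinuousFunction.evalCLM ℝ z)
  have ev_apply (φ : 𝓢(V, ℂ)) : ev (weightedDerivCLM k l φ) = ‖z‖ ^ k • (∂^{v} φ) z := by
    rw [SchwartzMap.iteratedLineDerivOp_eq_iteratedFDeriv]
    rfl
  have ev_integral := ev.integral_comp_comm (h.integrable_map (weightedDerivCLM k l))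
  simp only [ev_apply, integral_smul, ← (h.iteratedLineDerivOp v).eq_integral] at ev_integral
  rw [← ev_apply] at ev_integral
  exact ev_integral

/-- By Hahn-Banach, it suffices to consider functionals that factor through finitely many of the
bounded functions `x ↦ ‖x‖ ^ k • D^l φ x`. -/
theorem map_eq [CompleteSpace E] (h : IsSchwartzIntegral m Φ θ) (L : 𝓢(V, ℂ) →L[ℂ] E) :
    L θ = ∫ x, L (Φ x) ∂m := by
  rw [SeparatingDual.eq_iff_forall_dual_eq (R := ℂ)]
  intro ℓ
  let T : 𝓢(V, ℂ) →L[ℂ] ℂ := ℓ ∘L L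
  obtain ⟨s, C, -, hC⟩ := Seminorm.bound_of_continuous (schwartz_withSeminorms ℂ V ℂ)
    ((normSeminorm ℂ ℂ).comp T.toLinearMap) (continuous_norm.comp T.continuous)
  let J : 𝓢(V, ℂ) →L[ℂ] ((i : s) → BoundedForms V i.1.2) :=
    ContinuousLinearMap.pi fun i => weightedDerivCLM i.1.1 i.1.2
  have hTJ (φ : 𝓢(V, ℂ)) : ‖T φ‖ ≤ C * ‖J φ‖ :=
    (hC φ).trans <| mul_le_mul_of_nonneg_left (Seminorm.finset_sup_apply_le (norm_nonneg _)
      fun i hi => (seminorm_le_norm_weightedDerivCLM i.1 i.2 φ).trans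
        (norm_le_pi_norm (J φ) ⟨i, hi⟩)) C.2
  obtain ⟨G, hG⟩ := exists_strongDual_comp_eq J.toLinearMap T.toLinearMap hTJ
  have hJ : J θ = ∫ x, J (Φ x) ∂m := by
    refine funext fun i => (h.weightedDerivCLM_eq_integral i.1.1 i.1.2).trans ?_
    exact (eval_integral (fun i => h.integrable_map (weightedDerivCLM i.1.1 i.1.2)) i).symm
  calc ℓ (L θ) = G (∫ x, J (Φ x) ∂m) := by rw [← hJ]; exact (hG θ).symm
    _ = ∫ x, T (Φ x) ∂m := by
      rw [← G.integral_comp_comm (h.integrable_map J)]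
      exact integral_congr_ae (.of_forall fun x => hG (Φ x))
    _ = ℓ (∫ x, L (Φ x) ∂m) := ℓ.integral_comp_comm (h.integrable_map L)

theorem enorm_map_le (h : IsSchwartzIntegral m Φ θ) (L : 𝓢(V, ℂ) →L[ℂ] E) :
    ‖L θ‖ₑ ≤ ∫⁻ x, ‖L (Φ x)‖ₑ ∂m := by
  let ι : E →L[ℂ] UniformSpace.Completion E := UniformSpace.Completion.toComplL
  have enorm_ι (v : E) : ‖ι v‖ₑ = ‖v‖ₑ := by
    simp [ι, ← ofReal_norm]
  calc ‖L θ‖ₑ = ‖∫ x, (ι ∘L L) (Φ x) ∂m‖ₑ := by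
        rw [← h.map_eq (ι ∘L L), ContinuousLinearMap.comp_apply, enorm_ι]
    _ ≤ ∫⁻ x, ‖(ι ∘L L) (Φ x)‖ₑ ∂m := enorm_integral_le_lintegral_enorm _
    _ = ∫⁻ x, ‖L (Φ x)‖ₑ ∂m := by simp only [ContinuousLinearMap.comp_apply, enorm_ι]

lemma comp (h : IsSchwartzIntegral m Φ θ) (T : 𝓢(V, ℂ) →L[ℂ] 𝓢(V, ℂ)) :
    IsSchwartzIntegral m (fun x => T (Φ x)) (T θ) where
  continuous := T.continuous.comp h.continuous
  integrable_seminorm := h.integrable_seminorm_map T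
  eq_integral y := h.map_eq (evalAtCLM y ∘L T)

end IsSchwartzIntegral

end SchwartzIntegral

/-! ### Translations, modulations and convolutions of Schwartz functions -/

section Translation

lemma one_add_norm_le_mul {V : Type*} [SeminormedAddCommGroup V] (y z : V) :
    1 + ‖y‖ ≤ (1 + ‖z‖) * (1 + ‖y - z‖) := by
  have h : ‖y‖ ≤ ‖y - z‖ + ‖z‖ := by simpa using norm_add_le (y - z) z
  nlinarith [norm_nonneg z, norm_nonneg (y - z)]

variable {V : Type*} [NormedAddCommGroup V] [NormedSpace ℝ V]

/-- The continuous seminorm that controls `(1 + ‖x‖) ^ k * ‖D^i φ x‖` for all `i ≤ l`. -/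
def jetSeminorm (k l : ℕ) : Seminorm ℂ 𝓢(V, ℂ) :=
  (2 ^ k : ℝ≥0) • (Finset.Iic (k, l)).sup fun m => SchwartzMap.seminorm ℂ m.1 m.2

lemma continuous_finset_sup_seminorm {ι : Type*} {p : ι → Seminorm ℂ 𝓢(V, ℂ)} {s : Finset ι}
    (h : ∀ i ∈ s, Continuous (p i)) : Continuous (s.sup p : Seminorm ℂ 𝓢(V, ℂ)) :=
  Finset.sup_induction (p := fun q : Seminorm ℂ 𝓢(V, ℂ) => Continuous q) continuous_const
    (fun _ ha _ hb => ha.sup hb) h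

lemma continuous_jetSeminorm (k l : ℕ) : Continuous (jetSeminorm k l : Seminorm ℂ 𝓢(V, ℂ)) :=
  (continuous_finset_sup_seminorm fun m _ => continuous_seminorm m.1 m.2).const_smul (2 ^ k : ℝ≥0)

lemma one_add_norm_pow_mul_iteratedFDeriv_le_jetSeminorm (k : ℕ) {i l : ℕ} (hi : i ≤ l)
    (φ : 𝓢(V, ℂ)) (x : V) : (1 + ‖x‖) ^ k * ‖iteratedFDeriv ℝ i φ x‖ ≤ jetSeminorm k l φ :=
  SchwartzMap.one_add_le_sup_seminorm_apply (m := (k, l)) le_rfl hi φ x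

lemma one_add_norm_pow_mul_le_jetSeminorm (k : ℕ) (φ : 𝓢(V, ℂ)) (x : V) :
    (1 + ‖x‖) ^ k * ‖φ x‖ ≤ jetSeminorm k 0 φ := by
  simpa using one_add_norm_pow_mul_iteratedFDeriv_le_jetSeminorm k (le_refl 0) φ x

/-- The translation operator `φ ↦ φ (· - z)`. -/
abbrev translate (z : V) : 𝓢(V, ℂ) →L[ℂ] 𝓢(V, ℂ) := SchwartzMap.compSubConstCLM ℂ z

lemma iteratedFDeriv_translate (l : ℕ) (z : V) (φ : 𝓢(V, ℂ)) (y : V) :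
    iteratedFDeriv ℝ l (translate z φ) y = iteratedFDeriv ℝ l φ (y - z) :=
  iteratedFDeriv_comp_sub (f := φ) l z y

lemma seminorm_translate_le (k l : ℕ) (φ : 𝓢(V, ℂ)) (z : V) :
    SchwartzMap.seminorm ℂ k l (translate z φ) ≤ (1 + ‖z‖) ^ k * jetSeminorm k l φ := by
  refine SchwartzMap.seminorm_le_bound ℂ k l _ (by positivity) fun y => ?_
  rw [iteratedFDeriv_translate]
  calc ‖y‖ ^ k * ‖iteratedFDeriv ℝ l φ (y - z)‖
      ≤ ((1 + ‖z‖) * (1 + ‖y - z‖)) ^ k * ‖iteratedFDeriv ℝ l φ (y - z)‖ := by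
        gcongr
        linarith [one_add_norm_le_mul y z]
    _ = (1 + ‖z‖) ^ k * ((1 + ‖y - z‖) ^ k * ‖iteratedFDeriv ℝ l φ (y - z)‖) := by
        rw [mul_pow]
        ring
    _ ≤ (1 + ‖z‖) ^ k * jetSeminorm k l φ := by
        gcongr
        exact one_add_norm_pow_mul_iteratedFDeriv_le_jetSeminorm k le_rfl φ _

lemma seminorm_translate_sub_le (k l : ℕ) (φ : 𝓢(V, ℂ)) {z : V} (hz : ‖z‖ ≤ 1) :
    SchwartzMap.seminorm ℂ k l (translate z φ - φ) ≤ 2 ^ k * jetSeminorm k (l + 1) φ * ‖z‖ := by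
  refine SchwartzMap.seminorm_le_bound ℂ k l _ (by positivity) fun y => ?_
  have norm_deriv_le : ∀ w ∈ Metric.closedBall y 1,
      ‖fderiv ℝ (iteratedFDeriv ℝ l φ) w‖ ≤ 2 ^ k * jetSeminorm k (l + 1) φ / (1 + ‖y‖) ^ k := by
    intro w hw
    have hyw : 1 + ‖y‖ ≤ 2 * (1 + ‖w‖) := by
      linarith [norm_le_norm_add_norm_sub w y, mem_closedBall_iff_norm.1 hw, norm_nonneg w]
    rw [norm_fderiv_iteratedFDeriv, le_div_iff₀ (by positivity)]
    calc ‖iteratedFDeriv ℝ (l + 1) φ w‖ * (1 + ‖y‖) ^ k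
        ≤ ‖iteratedFDeriv ℝ (l + 1) φ w‖ * (2 * (1 + ‖w‖)) ^ k := by gcongr
      _ = 2 ^ k * ((1 + ‖w‖) ^ k * ‖iteratedFDeriv ℝ (l + 1) φ w‖) := by
        rw [mul_pow]
        ring
      _ ≤ 2 ^ k * jetSeminorm k (l + 1) φ := by
        gcongr
        exact one_add_norm_pow_mul_iteratedFDeriv_le_jetSeminorm k le_rfl φ w
  have mean_value := (convex_closedBall y 1).norm_image_sub_le_of_norm_fderiv_le (𝕜 := ℝ)
    (fun w _ => ((φ.smooth ⊤).differentiable_iteratedFDeriv (mod_cast ENat.natCast_lt_top l)) w)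
    norm_deriv_le (Metric.mem_closedBall_self zero_le_one) (y := y - z) (by simpa using hz)
  have iteratedFDeriv_sub : iteratedFDeriv ℝ l (translate z φ - φ : 𝓢(V, ℂ)) y =
      iteratedFDeriv ℝ l φ (y - z) - iteratedFDeriv ℝ l φ y := by
    rw [← iteratedFDeriv_translate]
    exact iteratedFDeriv_sub_apply ((translate z φ).contDiffAt l) (φ.contDiffAt l)
  rw [sub_sub_cancel_left, norm_neg] at mean_value
  rw [iteratedFDeriv_sub]
  calc _ ≤ (1 + ‖y‖) ^ k * (2 ^ k * jetSeminorm k (l + 1) φ / (1 + ‖y‖) ^ k * ‖z‖) := by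
        gcongr
        linarith
    _ = 2 ^ k * jetSeminorm k (l + 1) φ * ‖z‖ := by field_simp

lemma continuous_translate (φ : 𝓢(V, ℂ)) : Continuous fun z => translate z φ := by
  refine continuous_iff_continuousAt.2 fun z₀ => ?_
  refine ((schwartz_withSeminorms ℂ V ℂ).tendsto_nhds _ _).2 fun ⟨k, l⟩ ε hε => ?_
  have translate_add (z : V) : translate z φ = translate (z - z₀) (translate z₀ φ) := by
    rw [SchwartzMap.compSubConstCLM_comp, add_sub_cancel]
  have tendsto_bound : Filter.Tendsto
      (fun z => 2 ^ k * jetSeminorm k (l + 1) (translate z₀ φ) * ‖z - z₀‖) (nhds z₀) (nhds 0) := by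
    refine Continuous.tendsto' (by fun_prop) _ _ (by simp)
  filter_upwards [tendsto_bound.eventually_lt_const hε, Metric.closedBall_mem_nhds z₀ one_pos]
    with z hz hz₀
  rw [translate_add]
  exact (seminorm_translate_sub_le k l _ (mem_closedBall_iff_norm.1 hz₀)).trans_lt hz

lemma norm_iteratedFDeriv_mul_translate_le (a b : 𝓢(V, ℂ)) (k l M : ℕ) (ξ y : V) :
    (1 + ‖ξ‖) ^ M * (‖y‖ ^ k * ‖iteratedFDeriv ℝ l (fun y => b y * translate ξ a y) y‖) ≤
      2 ^ l * jetSeminorm M l a * jetSeminorm (k + M) l b := by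
  have hξ : 1 + ‖ξ‖ ≤ (1 + ‖y‖) * (1 + ‖y - ξ‖) := by
    simpa [norm_sub_rev] using one_add_norm_le_mul ξ y
  have summand_le (i : ℕ) (hi : i ≤ l) :
      (1 + ‖ξ‖) ^ M * (‖y‖ ^ k * (‖iteratedFDeriv ℝ i b y‖ *
        ‖iteratedFDeriv ℝ (l - i) (translate ξ a) y‖)) ≤
      jetSeminorm (k + M) l b * jetSeminorm M l a := by
    rw [iteratedFDeriv_translate]
    calc _ ≤ ((1 + ‖y‖) * (1 + ‖y - ξ‖)) ^ M * ((1 + ‖y‖) ^ k * (‖iteratedFDeriv ℝ i b y‖ *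
          ‖iteratedFDeriv ℝ (l - i) a (y - ξ)‖)) := by gcongr; linarith
      _ = ((1 + ‖y‖) ^ (k + M) * ‖iteratedFDeriv ℝ i b y‖) *
          ((1 + ‖y - ξ‖) ^ M * ‖iteratedFDeriv ℝ (l - i) a (y - ξ)‖) := by
          rw [mul_pow, pow_add]
          ring
      _ ≤ _ := mul_le_mul (one_add_norm_pow_mul_iteratedFDeriv_le_jetSeminorm _ hi b y)
          (one_add_norm_pow_mul_iteratedFDeriv_le_jetSeminorm _ (Nat.sub_le l i) a _)
          (by positivity) (by positivity)
  calc _ ≤ (1 + ‖ξ‖) ^ M * (‖y‖ ^ k * ∑ i ∈ Finset.range (l + 1), (l.choose i : ℝ) *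
        ‖iteratedFDeriv ℝ i b y‖ * ‖iteratedFDeriv ℝ (l - i) (translate ξ a) y‖) := by
        gcongr
        exact norm_iteratedFDeriv_mul_le (b.smooth ⊤) ((translate ξ a).smooth ⊤) y
          (mod_cast le_top)
    _ = ∑ i ∈ Finset.range (l + 1), (l.choose i : ℝ) * ((1 + ‖ξ‖) ^ M * (‖y‖ ^ k *
        (‖iteratedFDeriv ℝ i b y‖ * ‖iteratedFDeriv ℝ (l - i) (translate ξ a) y‖))) := by
        simp only [Finset.mul_sum]
        exact Finset.sum_congr rfl fun i _ => by ring
    _ ≤ ∑ i ∈ Finset.range (l + 1), (l.choose i : ℝ) *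
        (jetSeminorm (k + M) l b * jetSeminorm M l a) := by
        exact Finset.sum_le_sum fun i hi => mul_le_mul_of_nonneg_left
          (summand_le i (Finset.mem_range_succ_iff.1 hi)) (by positivity)
    _ = 2 ^ l * jetSeminorm M l a * jetSeminorm (k + M) l b := by
        rw [← Finset.sum_mul, ← Nat.cast_sum, Nat.sum_range_choose]
        push_cast
        ring

/-- The pointwise product of `b` with the translate `a (· - ξ)`. -/
def mulTranslate (a : 𝓢(V, ℂ)) (ξ : V) (b : 𝓢(V, ℂ)) : 𝓢(V, ℂ) :=
  SchwartzMap.pairing (ContinuousLinearMap.mul ℂ ℂ) b (translate ξ a)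

lemma mulTranslate_apply (a : 𝓢(V, ℂ)) (ξ : V) (b : 𝓢(V, ℂ)) (y : V) :
    mulTranslate a ξ b y = b y * a (y - ξ) := rfl

lemma continuous_mulTranslate (a b : 𝓢(V, ℂ)) : Continuous fun ξ => mulTranslate a ξ b :=
  (SchwartzMap.pairing (ContinuousLinearMap.mul ℂ ℂ) b).continuous.comp (continuous_translate a)

lemma exists_continuous_seminorm_mulTranslate_le (a : 𝓢(V, ℂ)) (M : ℕ)
    {q : Seminorm ℂ 𝓢(V, ℂ)} (hq : Continuous q) :
    ∃ q' : Seminorm ℂ 𝓢(V, ℂ), Continuous q' ∧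
      ∀ b ξ, (1 + ‖ξ‖) ^ M * q (mulTranslate a ξ b) ≤ q' b := by
  obtain ⟨s, C, -, hC⟩ := Seminorm.bound_of_continuous (schwartz_withSeminorms ℂ V ℂ) q hq
  let c (i : ℕ × ℕ) : ℝ≥0 := 2 ^ i.2 * ⟨jetSeminorm M i.2 a, apply_nonneg _ _⟩
  let S : Seminorm ℂ 𝓢(V, ℂ) := s.sup fun i => c i • jetSeminorm (i.1 + M) i.2
  have hS : Continuous S := continuous_finset_sup_seminorm fun i _ =>
    (continuous_jetSeminorm (i.1 + M) i.2).const_smul (c i)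
  refine ⟨C • S, hS.const_smul C, fun b ξ => ?_⟩
  have hpos : 0 < (1 + ‖ξ‖) ^ M := by positivity
  have seminorm_le : s.sup (schwartzSeminormFamily ℂ V ℂ) (mulTranslate a ξ b) ≤
      S b / (1 + ‖ξ‖) ^ M := by
    refine Seminorm.finset_sup_apply_le (by positivity) fun i hi => ?_
    refine SchwartzMap.seminorm_le_bound ℂ i.1 i.2 _ (by positivity) fun y => ?_
    rw [le_div_iff₀' hpos]
    refine le_trans ?_ (Seminorm.le_finset_sup_apply (x := b) hi)
    have mulTranslate_eq : (mulTranslate a ξ b : V → ℂ) = fun y => b y * translate ξ a y :=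
      funext (mulTranslate_apply a ξ b)
    rw [mulTranslate_eq]
    exact norm_iteratedFDeriv_mul_translate_le a b i.1 i.2 M ξ y
  calc (1 + ‖ξ‖) ^ M * q (mulTranslate a ξ b)
      ≤ (1 + ‖ξ‖) ^ M * (C * (S b / (1 + ‖ξ‖) ^ M)) := by
        gcongr
        exact (hC _).trans (mul_le_mul_of_nonneg_left seminorm_le C.2)
    _ = C * S b := by field_simp

lemma integrable_of_one_add_norm_pow_mul_le [FiniteDimensional ℝ V] [MeasurableSpace V]
    [BorelSpace V] {μ : Measure V} [μ.IsAddHaarMeasure] {E : Type*} [NormedAddCommGroup E]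
    {F : V → E} (hF : AEStronglyMeasurable F μ) {C : ℝ}
    (h : ∀ x, (1 + ‖x‖) ^ (Module.finrank ℝ V + 1) * ‖F x‖ ≤ C) : Integrable F μ := by
  have hn : (Module.finrank ℝ V : ℝ) < (Module.finrank ℝ V + 1 : ℕ) := by simp
  refine ((integrable_one_add_norm hn).const_mul C).mono' hF (.of_forall fun x => ?_)
  rw [Real.rpow_neg (by positivity), Real.rpow_natCast, ← div_eq_mul_inv,
    le_div_iff₀' (by positivity)]
  exact h x

end Translation

section Modulation

variable {d : ℕ}

/-- The modulation operator `φ ↦ e^{2πi y·ξ} φ y`. -/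
def modulate (ξ : Rd d) : 𝓢(Rd d, ℂ) →L[ℂ] 𝓢(Rd d, ℂ) :=
  SchwartzMap.smulLeftCLM ℂ (character (-ξ))

lemma modulate_apply (ξ y : Rd d) (φ : 𝓢(Rd d, ℂ)) :
    modulate ξ φ y = character (-ξ) y * φ y := by
  simp [modulate, SchwartzMap.smulLeftCLM_apply_apply (hasTemperateGrowth_character (-ξ))]

lemma norm_character (ξ y : Rd d) : ‖character ξ y‖ = 1 := by
  simp [character, Complex.norm_exp]

lemma character_add_left (ξ η y : Rd d) :
    character (ξ + η) y = character ξ y * character η y := by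
  rw [character, character, character, ← Complex.exp_add, inner_add_right]
  push_cast; ring_nf

lemma character_add_right (ξ x y : Rd d) :
    character ξ (x + y) = character ξ x * character ξ y := by
  rw [character, character, character, ← Complex.exp_add, inner_add_left]
  push_cast; ring_nf

lemma character_comm (ξ y : Rd d) : character ξ y = character y ξ := by
  rw [character, character, real_inner_comm]

lemma character_neg_neg (ξ y : Rd d) : character (-ξ) (-y) = character ξ y := by
  simp [character]

lemma modulate_add (ξ η : Rd d) (φ : 𝓢(Rd d, ℂ)) :
    modulate (ξ + η) φ = modulate ξ (modulate η φ) := by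
  ext y
  simp only [modulate_apply, neg_add, character_add_left, mul_assoc]

@[simp] lemma modulate_zero (φ : 𝓢(Rd d, ℂ)) : modulate 0 φ = φ := by
  ext y
  simp [modulate_apply, character]

lemma fourier_eq_integral_character (φ : 𝓢(Rd d, ℂ)) (η : Rd d) :
    𝓕 φ η = ∫ y, character η y * φ y := by
  rw [SchwartzMap.fourier_coe, Real.fourier_eq']
  refine integral_congr_ae (.of_forall fun y => ?_)
  simp only [character, smul_eq_mul]
  congr 2
  push_cast; ring

lemma fourierInv_eq_integral_character (φ : 𝓢(Rd d, ℂ)) (η : Rd d) :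
    𝓕⁻ φ η = ∫ y, character (-η) y * φ y := by
  rw [SchwartzMap.fourierInv_coe, Real.fourierInv_eq']
  refine integral_congr_ae (.of_forall fun y => ?_)
  simp only [character, smul_eq_mul, inner_neg_right]
  congr 2
  push_cast; ring

lemma fourier_modulate (ξ : Rd d) (φ : 𝓢(Rd d, ℂ)) : 𝓕 (modulate ξ φ) = translate ξ (𝓕 φ) := by
  ext η
  rw [SchwartzMap.compSubConstCLM_apply, fourier_eq_integral_character,
    fourier_eq_integral_character]
  simp only [modulate_apply, sub_eq_add_neg η, character_add_left, mul_assoc]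

lemma continuous_modulate (φ : 𝓢(Rd d, ℂ)) : Continuous fun ξ => modulate ξ φ := by
  refine ((fourierInvCLM ℂ 𝓢(Rd d, ℂ)).continuous.comp (continuous_translate (𝓕 φ))).congr
    fun ξ => ?_
  simp [← fourier_modulate]

end Modulation

section SchwartzConv

variable {d : ℕ}

lemma fourier_injective : Function.Injective (𝓕 : 𝓢(Rd d, ℂ) → 𝓢(Rd d, ℂ)) :=
  (fourierEquiv ℂ 𝓢(Rd d, ℂ)).injective

lemma fourier_schwartzConv_apply (a b : 𝓢(Rd d, ℂ)) (y : Rd d) :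
    𝓕 (schwartzConv a b) y = 𝓕 a y * 𝓕 b y :=
  congrArg (· y) (SchwartzMap.fourier_convolution (ContinuousLinearMap.mul ℂ ℂ) a b)

lemma schwartzConv_comm (a b : 𝓢(Rd d, ℂ)) : schwartzConv a b = schwartzConv b a := by
  apply fourier_injective
  ext y
  simp only [fourier_schwartzConv_apply, mul_comm]

lemma schwartzConv_assoc (a b c : 𝓢(Rd d, ℂ)) :
    schwartzConv (schwartzConv a b) c = schwartzConv a (schwartzConv b c) := by
  apply fourier_injective
  ext y
  simp only [fourier_schwartzConv_apply, mul_assoc]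

lemma modulate_schwartzConv (ξ : Rd d) (a b : 𝓢(Rd d, ℂ)) :
    modulate ξ (schwartzConv a b) = schwartzConv (modulate ξ a) (modulate ξ b) := by
  apply fourier_injective
  ext y
  simp only [fourier_schwartzConv_apply, fourier_modulate, SchwartzMap.compSubConstCLM_apply]

lemma translate_schwartzConv (z : Rd d) (a b : 𝓢(Rd d, ℂ)) :
    translate z (schwartzConv a b) = schwartzConv (translate z a) b := by
  rw [schwartzConv_comm a, schwartzConv_comm (translate z a)]
  ext y
  simp only [SchwartzMap.compSubConstCLM_apply, schwartzConv_apply, sub_right_comm]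

lemma isSchwartzIntegral_schwartzConv (a b : 𝓢(Rd d, ℂ)) :
    IsSchwartzIntegral volume (fun w => b w • translate w a) (schwartzConv a b) := by
  have hcont : Continuous fun w => b w • translate w a :=
    b.continuous.smul (continuous_translate a)
  refine ⟨hcont, fun k l => ?_, fun y => ?_⟩
  · refine integrable_of_one_add_norm_pow_mul_le
      (C := jetSeminorm (Module.finrank ℝ (Rd d) + 1 + k) 0 b * jetSeminorm k l a)
      ((continuous_seminorm k l).comp hcont).aestronglyMeasurable fun w => ?_
    rw [Real.norm_of_nonneg (apply_nonneg _ _), map_smul_eq_mul]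
    calc _ ≤ (1 + ‖w‖) ^ (Module.finrank ℝ (Rd d) + 1) *
          (‖b w‖ * ((1 + ‖w‖) ^ k * jetSeminorm k l a)) := by
          gcongr
          exact seminorm_translate_le k l a w
      _ = (1 + ‖w‖) ^ (Module.finrank ℝ (Rd d) + 1 + k) * ‖b w‖ * jetSeminorm k l a := by ring
      _ ≤ _ := by
          gcongr
          exact one_add_norm_pow_mul_le_jetSeminorm _ b w
  · rw [schwartzConv_comm, schwartzConv_apply]
    rfl

lemma fourierInv_mulTranslate_fourier (θ κ : 𝓢(Rd d, ℂ)) (ξ : Rd d) :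
    𝓕⁻ (mulTranslate (𝓕 κ) ξ (𝓕 θ)) = schwartzConv θ (modulate ξ κ) := by
  apply fourier_injective
  ext y
  simp [fourier_schwartzConv_apply, fourier_modulate, mulTranslate_apply]

lemma isSchwartzIntegral_mulTranslate (a b : 𝓢(Rd d, ℂ)) :
    IsSchwartzIntegral volume (fun ξ => mulTranslate a ξ b) ((∫ w, a w) • b) := by
  refine ⟨continuous_mulTranslate a b, fun k l => ?_, fun y => ?_⟩
  · obtain ⟨q, -, hq⟩ := exists_continuous_seminorm_mulTranslate_le a
      (Module.finrank ℝ (Rd d) + 1) (continuous_seminorm k l)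
    refine integrable_of_one_add_norm_pow_mul_le
      ((continuous_seminorm k l).comp (continuous_mulTranslate a b)).aestronglyMeasurable
      (C := q b) fun ξ => ?_
    rw [Real.norm_of_nonneg (apply_nonneg _ _)]
    exact hq b ξ
  · simp only [mulTranslate_apply, smul_apply, smul_eq_mul]
    rw [integral_const_mul, integral_sub_left_eq_self (fun w => a w) volume y, mul_comm]

/-- The reproducing formula. On the Fourier side it says that the translates of `𝓕 κ` integrate to
the constant `κ 0`. -/
lemma isSchwartzIntegral_schwartzConv_modulate (θ κ : 𝓢(Rd d, ℂ)) :
    IsSchwartzIntegral volume (fun ξ => schwartzConv θ (modulate ξ κ)) (κ 0 • θ) := by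
  have hκ : κ 0 = ∫ w, 𝓕 κ w := by
    have fourierInv_fourier : 𝓕⁻ (𝓕 κ) = κ := by simp
    rw [← fourierInv_fourier, fourierInv_eq_integral_character, fourierInv_fourier]
    simp [character]
  have h := (isSchwartzIntegral_mulTranslate (𝓕 κ) (𝓕 θ)).comp (fourierInvCLM ℂ 𝓢(Rd d, ℂ))
  simpa [fourierInv_mulTranslate_fourier, ← hκ] using h

lemma exists_continuous_seminorm_schwartzConv_modulate_le (γ : 𝓢(Rd d, ℂ)) (M : ℕ)
    {q : Seminorm ℂ 𝓢(Rd d, ℂ)} (hq : Continuous q) :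
    ∃ q' : Seminorm ℂ 𝓢(Rd d, ℂ), Continuous q' ∧
      ∀ ψ ξ, (1 + ‖ξ‖) ^ M * q (schwartzConv ψ (modulate ξ γ)) ≤ q' ψ := by
  obtain ⟨q', hq', hle⟩ := exists_continuous_seminorm_mulTranslate_le (𝓕 γ) M
    (q := q.comp (fourierInvCLM ℂ 𝓢(Rd d, ℂ)).toLinearMap)
    (hq.comp (fourierInvCLM ℂ 𝓢(Rd d, ℂ)).continuous)
  refine ⟨q'.comp (fourierCLM ℂ 𝓢(Rd d, ℂ)).toLinearMap,
    hq'.comp (fourierCLM ℂ 𝓢(Rd d, ℂ)).continuous, fun ψ ξ => ?_⟩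
  rw [← fourierInv_mulTranslate_fourier]
  exact hle (𝓕 ψ) ξ

end SchwartzConv

/-! ### Smoothings of tempered distributions and change of the window -/

section Smoothing

variable {d : ℕ}

lemma ofReal_smul_seminorm {F : Type*} [AddCommGroup F] [Module ℂ F] (c : ℝ≥0)
    (q : Seminorm ℂ F) (v : F) : ENNReal.ofReal ((c • q) v) = c * ENNReal.ofReal (q v) :=
  (ENNReal.ofReal_mul c.2).trans (by rw [← ENNReal.ofReal_coe_nnreal]; rfl)

lemma ofReal_le_mul_weight_neg {M : ℕ} {x : Rd d} {t c : ℝ} (ht : 0 ≤ t)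
    (h : (1 + ‖x‖) ^ M * t ≤ c) : ENNReal.ofReal t ≤ ENNReal.ofReal c * weight (-(M : ℝ)) x := by
  rw [← weight_le_iff_le_weight_neg_mul, weight, Real.rpow_natCast,
    ← ENNReal.ofReal_mul (pow_nonneg (bracket_pos x).le M)]
  refine ENNReal.ofReal_le_ofReal (le_trans ?_ h)
  gcongr
  · exact (bracket_pos x).le
  · exact bracket_le_one_add_norm x

lemma enorm_le_jetSeminorm_mul_weight (M : ℕ) (φ : 𝓢(Rd d, ℂ)) (x : Rd d) :
    ‖φ x‖ₑ ≤ ENNReal.ofReal (jetSeminorm M 0 φ) * weight (-(M : ℝ)) x := by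
  rw [← ofReal_norm]
  exact ofReal_le_mul_weight_neg (norm_nonneg _) (one_add_norm_pow_mul_le_jetSeminorm M φ x)

lemma exists_continuous_seminorm_schwartzConv_modulate_le_weight (γ : 𝓢(Rd d, ℂ)) (M : ℕ)
    {q : Seminorm ℂ 𝓢(Rd d, ℂ)} (hq : Continuous q) :
    ∃ q' : Seminorm ℂ 𝓢(Rd d, ℂ), Continuous q' ∧ ∀ ψ ξ,
      ENNReal.ofReal (q (schwartzConv ψ (modulate ξ γ))) ≤
        ENNReal.ofReal (q' ψ) * weight (-(M : ℝ)) ξ := by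
  obtain ⟨q', hq', hle⟩ := exists_continuous_seminorm_schwartzConv_modulate_le γ M hq
  exact ⟨q', hq', fun ψ ξ => ofReal_le_mul_weight_neg (apply_nonneg _ _) (hle ψ ξ)⟩

variable {E : Type*} [NormedAddCommGroup E] [NormedSpace ℂ E]

/-- The map `φ ↦ (f * φ) x`. -/
def smoothingCLM (f : 𝓢'(Rd d, E)) (x : Rd d) : 𝓢(Rd d, ℂ) →L[ℂ] E :=
  (f : 𝓢(Rd d, ℂ) →L[ℂ] E) ∘L reflectAt x

lemma smoothingCLM_apply (f : 𝓢'(Rd d, E)) (x : Rd d) (φ : 𝓢(Rd d, ℂ)) :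
    smoothingCLM f x φ = smoothing f φ x := rfl

lemma smoothing_translate (f : 𝓢'(Rd d, E)) (w : Rd d) (φ : 𝓢(Rd d, ℂ)) (x : Rd d) :
    smoothing f (translate w φ) x = smoothing f φ (x - w) := by
  have reflectAt_translate : reflectAt x (translate w φ) = reflectAt (x - w) φ := by
    ext y
    simp only [reflectAt_apply, SchwartzMap.compSubConstCLM_apply, sub_right_comm]
  rw [smoothing, reflectAt_translate, smoothing]

lemma continuous_smoothing (f : 𝓢'(Rd d, E)) (φ : 𝓢(Rd d, ℂ)) : Continuous (smoothing f φ) := by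
  refine ((smoothingCLM f 0).continuous.comp
    ((continuous_translate φ).comp continuous_neg)).congr fun x => ?_
  simp [smoothingCLM_apply, smoothing_translate]

lemma stronglyMeasurable_uncurry_smoothing_modulate (f : 𝓢'(Rd d, E)) (φ : 𝓢(Rd d, ℂ)) :
    StronglyMeasurable (Function.uncurry fun x ξ => smoothing f (modulate ξ φ) x) :=
  stronglyMeasurable_uncurry_of_continuous_of_stronglyMeasurable
    (fun ξ => continuous_smoothing f (modulate ξ φ))
    fun x => ((smoothingCLM f x).continuous.comp (continuous_modulate φ)).stronglyMeasurable

lemma enorm_smoothing_schwartzConv_le (f : 𝓢'(Rd d, E)) (a b : 𝓢(Rd d, ℂ)) (x : Rd d) :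
    ‖smoothing f (schwartzConv a b) x‖ₑ ≤ ∫⁻ w, ‖b w‖ₑ * ‖smoothing f a (x - w)‖ₑ := by
  refine ((isSchwartzIntegral_schwartzConv a b).enorm_map_le (smoothingCLM f x)).trans_eq ?_
  simp only [map_smul, enorm_smul, smoothingCLM_apply, smoothing_translate]

/-- The absolute value of the smoothing of `f` with the modulated window `M_ξ γ`: up to an
involution of the window, this is the absolute value of the short-time Fourier transform. -/
def amplitude (f : 𝓢'(Rd d, E)) (γ : 𝓢(Rd d, ℂ)) (x ξ : Rd d) : ℝ≥0∞ :=
  ‖smoothing f (modulate ξ γ) x‖ₑ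

lemma measurable_amplitude (f : 𝓢'(Rd d, E)) (γ : 𝓢(Rd d, ℂ)) :
    Measurable (Function.uncurry (amplitude f γ)) :=
  (stronglyMeasurable_uncurry_smoothing_modulate f γ).enorm

lemma amplitude_zero_right (f : 𝓢'(Rd d, E)) (γ : 𝓢(Rd d, ℂ)) (x : Rd d) :
    amplitude f γ x 0 = ‖smoothing f γ x‖ₑ := by
  rw [amplitude, modulate_zero]

/-- The complex conjugate of a Schwartz function. -/
def conjugate (g : 𝓢(Rd d, ℂ)) : 𝓢(Rd d, ℂ) :=
  SchwartzMap.postcompCLM (𝕜 := ℝ) (Complex.conjCLE : ℂ →L[ℝ] ℂ) g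

lemma conjugate_apply (g : 𝓢(Rd d, ℂ)) (y : Rd d) : conjugate g y = (starRingEnd ℂ) (g y) := by
  simp [conjugate]

lemma conjugate_ne_zero {g : 𝓢(Rd d, ℂ)} (hg : g ≠ 0) : conjugate g ≠ 0 := by
  contrapose! hg
  ext y
  simpa [conjugate_apply] using DFunLike.congr_fun hg y

/-- The involution `g ↦ conj (g (-·))`. -/
def involution (g : 𝓢(Rd d, ℂ)) : 𝓢(Rd d, ℂ) := conjugate (reflectAt 0 g)

lemma involution_apply (g : 𝓢(Rd d, ℂ)) (y : Rd d) :
    involution g y = (starRingEnd ℂ) (g (-y)) := by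
  simp [involution, conjugate_apply, reflectAt_apply]

lemma involution_ne_zero {g : 𝓢(Rd d, ℂ)} (hg : g ≠ 0) : involution g ≠ 0 := by
  contrapose! hg
  ext y
  simpa [involution_apply] using DFunLike.congr_fun hg (-y)

lemma schwartzConv_involution_zero_ne_zero {γ : 𝓢(Rd d, ℂ)} (hγ : γ ≠ 0) :
    schwartzConv γ (involution γ) 0 ≠ 0 := by
  have eq_integral_norm_sq : schwartzConv γ (involution γ) 0 = ((∫ y, ‖γ y‖ ^ 2 : ℝ) : ℂ) := by
    rw [schwartzConv_apply, ← integral_complex_ofReal]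
    refine integral_congr_ae (.of_forall fun y => ?_)
    simp [involution_apply, Complex.mul_conj, Complex.normSq_eq_norm_sq]
  have integrable_norm_sq : Integrable fun y => ‖γ y‖ ^ 2 := by
    simpa using (γ.memLp 2 volume).integrable_norm_pow (by norm_num)
  have integral_pos : 0 < ∫ y, ‖γ y‖ ^ 2 := by
    rw [integral_pos_iff_support_of_nonneg (fun y => by positivity) integrable_norm_sq]
    obtain ⟨y, hy⟩ := DFunLike.exists_ne hγ
    exact (γ.continuous.norm.pow 2).isOpen_support.measure_pos volume ⟨y, by simpa using hy⟩
  rw [eq_integral_norm_sq]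
  exact_mod_cast integral_pos.ne'

/-- This combines the reproducing formula for the window `γ * ρ` with
`M_η ψ * M_ξ (γ * ρ) = M_ξ γ * M_η (ψ * M_(ξ - η) ρ)`. -/
lemma enorm_mul_amplitude_le (f : 𝓢'(Rd d, E)) (γ ρ ψ : 𝓢(Rd d, ℂ)) (x η : Rd d) :
    ‖schwartzConv γ ρ 0‖ₑ * amplitude f ψ x η ≤
      ∫⁻ ξ, ∫⁻ w, ‖schwartzConv ψ (modulate (ξ - η) ρ) w‖ₑ * amplitude f γ (x - w) ξ := by
  have window_eq (ξ : Rd d) : schwartzConv (modulate η ψ) (modulate ξ (schwartzConv γ ρ)) =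
      schwartzConv (modulate ξ γ) (modulate η (schwartzConv ψ (modulate (ξ - η) ρ))) := by
    rw [modulate_schwartzConv η, ← modulate_add, add_sub_cancel, modulate_schwartzConv,
      ← schwartzConv_assoc, ← schwartzConv_assoc, schwartzConv_comm (modulate η ψ)]
  have reproducing := (isSchwartzIntegral_schwartzConv_modulate (modulate η ψ)
    (schwartzConv γ ρ)).enorm_map_le (smoothingCLM f x)
  rw [map_smul, enorm_smul] at reproducing
  refine reproducing.trans (lintegral_mono fun ξ => ?_)
  rw [window_eq]
  refine (enorm_smoothing_schwartzConv_le f _ _ x).trans_eq (lintegral_congr fun w => ?_)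
  have enorm_modulate (θ : 𝓢(Rd d, ℂ)) : ‖modulate η θ w‖ₑ = ‖θ w‖ₑ := by
    rw [modulate_apply, enorm_mul, ← ofReal_norm (character _ _), norm_character,
      ENNReal.ofReal_one, one_mul]
  rw [enorm_modulate, amplitude]

lemma lintegral_lintegral_weight_mul_eq_smear (M : ℝ) (Φ : Rd d → Rd d → ℝ≥0∞) (x η : Rd d) :
    ∫⁻ ξ, ∫⁻ w, weight (-M) (ξ - η) * weight (-M) w * Φ (x - w) ξ =
      smear M (fun ξ => smear M (fun y => Φ y ξ) x) η := by
  rw [← lintegral_sub_left_eq_self _ η]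
  refine lintegral_congr fun ξ => ?_
  rw [sub_sub_cancel_left, weight_neg]
  refine Eq.trans ?_ (lintegral_mul_const' _ _ (weight_ne_top _ _))
  exact lintegral_congr fun w => by ring

theorem exists_convDominated_amplitude {γ : 𝓢(Rd d, ℂ)} (hγ : γ ≠ 0) (M : ℕ) :
    ∃ q : Seminorm ℂ 𝓢(Rd d, ℂ), Continuous q ∧
      ∀ ψ {E : Type*} [NormedAddCommGroup E] [NormedSpace ℂ E] (f : 𝓢'(Rd d, E)),
        ConvDominated (q ψ).toNNReal M (amplitude f γ) (amplitude f ψ) := by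
  let ρ := involution γ
  obtain ⟨q, hq, hle⟩ := exists_continuous_seminorm_schwartzConv_modulate_le_weight ρ M
    (continuous_jetSeminorm M 0)
  have hκ : ‖schwartzConv γ ρ 0‖₊ ≠ 0 := by simpa using schwartzConv_involution_zero_ne_zero hγ
  let c := ‖schwartzConv γ ρ 0‖₊⁻¹
  refine ⟨c • q, hq.const_smul c, fun ψ E _ _ f x η => ?_⟩
  have kernel_le (ξ w : Rd d) : ‖schwartzConv ψ (modulate (ξ - η) ρ) w‖ₑ ≤
      ENNReal.ofReal (q ψ) * (weight (-(M : ℝ)) (ξ - η) * weight (-(M : ℝ)) w) := by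
    grw [enorm_le_jetSeminorm_mul_weight M, hle, mul_assoc]
  have toNNReal_eq : (((c • q) ψ).toNNReal : ℝ≥0∞) = c * ENNReal.ofReal (q ψ) :=
    ofReal_smul_seminorm c q ψ
  calc amplitude f ψ x η
      = c * (‖schwartzConv γ ρ 0‖ₑ * amplitude f ψ x η) := by
        rw [← mul_assoc, enorm_eq_nnnorm, ← ENNReal.coe_mul, inv_mul_cancel₀ hκ, ENNReal.coe_one,
          one_mul]
    _ ≤ c * ∫⁻ ξ, ∫⁻ w, ENNReal.ofReal (q ψ) *
          (weight (-(M : ℝ)) (ξ - η) * weight (-(M : ℝ)) w * amplitude f γ (x - w) ξ) := by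
        grw [enorm_mul_amplitude_le f γ ρ ψ x η]
        refine mul_le_mul' le_rfl (lintegral_mono fun ξ => lintegral_mono fun w => ?_)
        rw [← mul_assoc]
        exact mul_le_mul' (kernel_le ξ w) le_rfl
    _ = _ := by
        simp only [lintegral_const_mul' _ _ ENNReal.ofReal_ne_top,
          lintegral_lintegral_weight_mul_eq_smear]
        rw [toNNReal_eq, mul_assoc]

variable {p q : ℝ≥0∞} {γ : 𝓢(Rd d, ℂ)}

theorem exists_mixedNorm_amplitude_le (hp : 1 ≤ p) (hq : 1 ≤ q) (r s : ℝ) (hγ : γ ≠ 0)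
    (ψ : 𝓢(Rd d, ℂ)) :
    ∃ C : ℝ≥0, ∀ {E : Type*} [NormedAddCommGroup E] [NormedSpace ℂ E] (f : 𝓢'(Rd d, E)),
      mixedNorm p q r s (amplitude f ψ) ≤ C * mixedNorm p q r s (amplitude f γ) := by
  obtain ⟨M, hM⟩ := exists_nat_gt (max (d + |r|) (d + |s|))
  obtain ⟨Q, -, hQ⟩ := exists_convDominated_amplitude hγ M
  obtain ⟨C, hC⟩ := ConvDominated.exists_mixedNorm_le (max_lt_iff.1 hM).1 (max_lt_iff.1 hM).2
  refine ⟨C * (Q ψ).toNNReal, fun f => ?_⟩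
  rw [ENNReal.coe_mul]
  exact (hC hp hq (measurable_amplitude f γ) (hQ ψ f)).2.2

theorem exists_continuous_seminorm_amplitude_le (hp : 1 ≤ p) (hq : 1 ≤ q) {r s : ℝ} (hγ : γ ≠ 0)
    {f : 𝓢'(Rd d, E)} (hf : mixedNorm p q r s (amplitude f γ) < ∞) :
    ∃ Q : Seminorm ℂ 𝓢(Rd d, ℂ), Continuous Q ∧ ∀ ψ η,
      (∀ x, amplitude f ψ x η ≤ ENNReal.ofReal (Q ψ) * weight (-s) η * weight (-r) x) ∧
      weightedNorm p r (fun x => amplitude f ψ x η) ≤ ENNReal.ofReal (Q ψ) * weight (-s) η := by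
  obtain ⟨M, hM⟩ := exists_nat_gt (max (d + |r|) (d + |s|))
  obtain ⟨Q, hQ_cont, hQ⟩ := exists_convDominated_amplitude hγ M
  obtain ⟨C, hC⟩ := ConvDominated.exists_mixedNorm_le (max_lt_iff.1 hM).1 (max_lt_iff.1 hM).2
  lift mixedNorm p q r s (amplitude f γ) to ℝ≥0 using hf.ne with N hN
  refine ⟨(C * N) • Q, hQ_cont.const_smul (C * N), fun ψ η => ?_⟩
  have ofReal_eq : ENNReal.ofReal (((C * N) • Q) ψ) = C * (Q ψ).toNNReal * N := by
    rw [ofReal_smul_seminorm, ENNReal.coe_mul, mul_right_comm]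
    rfl
  have bounds := hC hp hq (measurable_amplitude f γ) (hQ ψ f)
  rw [← hN, ← ofReal_eq] at bounds
  exact ⟨fun x => weight_le_iff_le_weight_neg_mul.1 (weight_le_iff_le_weight_neg_mul.1
    (bounds.1 x η)), weight_le_iff_le_weight_neg_mul.1 (bounds.2.1 η)⟩

/-! ### The norms of modulation and amalgam spaces -/

lemma reflectAt_modulate_involution (g : 𝓢(Rd d, ℂ)) (x ξ : Rd d) :
    reflectAt x (modulate ξ (involution g)) = character (-ξ) x • conjShift g x ξ := by
  ext y
  rw [reflectAt_apply, modulate_apply, involution_apply, neg_sub, sub_eq_add_neg x y,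
    character_add_right, character_neg_neg, smul_apply, conjShift_apply, smul_eq_mul, mul_assoc]
  rfl

lemma amplitude_involution (f : 𝓢'(Rd d, E)) (g : 𝓢(Rd d, ℂ)) (x ξ : Rd d) :
    amplitude f (involution g) x ξ = ‖stft g f x ξ‖ₑ := by
  rw [amplitude, smoothing, reflectAt_modulate_involution, map_smul, enorm_smul,
    ← ofReal_norm (character (-ξ) x), norm_character, ENNReal.ofReal_one, one_mul, stft]

lemma eLpNorm_bracket_rpow_mul_norm {F : Type*} [NormedAddCommGroup F] (p : ℝ≥0∞) (r : ℝ)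
    (v : Rd d → F) :
    eLpNorm (fun x => bracket x ^ r * ‖v x‖) p volume = weightedNorm p r fun x => ‖v x‖ₑ := by
  refine eLpNorm_congr_enorm_ae (.of_forall fun x => ?_)
  rw [enorm_mul, enorm_norm, Real.enorm_of_nonneg (Real.rpow_nonneg (bracket_pos x).le _),
    enorm_eq_self, weight]

lemma weightedNorm_comp_neg {a : Rd d → ℝ≥0∞} (ha : Measurable a) (p : ℝ≥0∞) (r : ℝ) :
    weightedNorm p r (fun x => a (-x)) = weightedNorm p r a := by
  have norm_comp_neg := eLpNorm_comp_measurePreserving (p := p)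
    (g := fun x => weight r x * a x) ((measurable_weight r).mul ha).aestronglyMeasurable
    (Measure.measurePreserving_neg (volume : Measure (Rd d)))
  simpa only [weightedNorm, Function.comp_def, weight_neg] using norm_comp_neg

lemma modulationNorm_eq_mixedNorm (g : 𝓢(Rd d, ℂ)) (p q : ℝ≥0∞) (r s : ℝ) (f : 𝓢'(Rd d, E)) :
    modulationNorm g p q r s f = mixedNorm p q r s (amplitude f (involution g)) := by
  simp only [modulationNorm, eLpNorm_bracket_rpow_mul_norm, mixedNorm, weightedNorm,
    amplitude_involution, weight, mul_comm]

/-- The window `𝓕⁻¹ (conj g)`, with respect to which the smoothings of `𝓕⁻¹ μ` are values of the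
short-time Fourier transform `V_g μ`. -/
def dualWindow (g : 𝓢(Rd d, ℂ)) : 𝓢(Rd d, ℂ) := 𝓕⁻ (conjugate g)

lemma fourier_dualWindow (g : 𝓢(Rd d, ℂ)) : 𝓕 (dualWindow g) = conjugate g := by
  simp [dualWindow]

lemma dualWindow_ne_zero {g : 𝓢(Rd d, ℂ)} (hg : g ≠ 0) : dualWindow g ≠ 0 :=
  (map_ne_zero_iff (fourierEquiv ℂ 𝓢(Rd d, ℂ)).symm
    (fourierEquiv ℂ 𝓢(Rd d, ℂ)).symm.injective).2 (conjugate_ne_zero hg)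

lemma fourierInv_reflectAt_modulate_dualWindow (g : 𝓢(Rd d, ℂ)) (x t : Rd d) :
    𝓕⁻ (reflectAt t (modulate x (dualWindow g))) = conjShift g x (-t) := by
  ext η
  rw [conjShift_apply, ← conjugate_apply, ← fourier_dualWindow, fourierInv_eq_integral_character,
    fourier_eq_integral_character, ← integral_sub_left_eq_self _ volume t, ← integral_const_mul]
  refine integral_congr_ae (.of_forall fun y => ?_)
  simp only [reflectAt_apply, sub_sub_cancel, modulate_apply]
  rw [sub_eq_add_neg t y, character_add_right, character_neg_neg, sub_eq_add_neg η x,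
    character_add_left, character_comm (-η), ← character_neg_neg t, neg_neg]
  have character_eq : Complex.exp (-(2 * Real.pi * Complex.I) * (inner ℝ η (-t) : ℝ)) =
      character (-t) η := rfl
  rw [character_eq]
  ring

lemma amplitude_fourierInv_dualWindow (μ : 𝓢'(Rd d, E)) (g : 𝓢(Rd d, ℂ)) (t x : Rd d) :
    amplitude (𝓕⁻ μ) (dualWindow g) t x = ‖stft g μ x (-t)‖ₑ := by
  rw [amplitude, smoothing, TemperedDistribution.fourierInv_apply,
    fourierInv_reflectAt_modulate_dualWindow, stft]

lemma amalgamNorm_eq_mixedNorm (g : 𝓢(Rd d, ℂ)) (p q : ℝ≥0∞) (r s : ℝ) (μ : 𝓢'(Rd d, E)) :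
    amalgamNorm g p q r s μ = mixedNorm p q r s (amplitude (𝓕⁻ μ) (dualWindow g)) := by
  have inner_eq (x : Rd d) : weightedNorm p r (fun ξ => ‖stft g μ x ξ‖ₑ) =
      weightedNorm p r fun t => amplitude (𝓕⁻ μ) (dualWindow g) t x := by
    have measurable_slice : Measurable fun t => amplitude (𝓕⁻ μ) (dualWindow g) t x :=
      (measurable_amplitude (𝓕⁻ μ) (dualWindow g)).of_uncurry_right
    rw [← weightedNorm_comp_neg measurable_slice]
    simp only [amplitude_fourierInv_dualWindow, neg_neg]
  simp only [amalgamNorm, eLpNorm_bracket_rpow_mul_norm, inner_eq]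
  simp only [mixedNorm, weightedNorm, weight, mul_comm]

end Smoothing

/-! ### Existence of convolutions -/

section Existence

lemma exists_clm_eq_integral {V E Y : Type*} [NormedAddCommGroup V] [NormedSpace ℝ V]
    [NormedAddCommGroup E] [NormedSpace ℂ E] [MeasurableSpace Y] {m : Measure Y}
    {A : Y → 𝓢(V, ℂ) →L[ℂ] E} (hA : ∀ φ, AEStronglyMeasurable (fun y => A y φ) m)
    {q : Seminorm ℂ 𝓢(V, ℂ)} (hq : Continuous q)
    (hle : ∀ φ, ∫⁻ y, ‖A y φ‖ₑ ∂m ≤ ENNReal.ofReal (q φ)) :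
    ∃ L : 𝓢(V, ℂ) →L[ℂ] E, ∀ φ, L φ = ∫ y, A y φ ∂m := by
  have integrable (φ : 𝓢(V, ℂ)) : Integrable (fun y => A y φ) m :=
    ⟨hA φ, (hle φ).trans_lt ENNReal.ofReal_lt_top⟩
  let L : 𝓢(V, ℂ) →ₗ[ℂ] E :=
    { toFun := fun φ => ∫ y, A y φ ∂m
      map_add' := fun φ ψ => by
        simpa only [map_add] using integral_add (integrable φ) (integrable ψ)
      map_smul' := fun c φ => by
        simpa only [map_smul, RingHom.id_apply] using integral_smul c fun y => A y φ }
  have norm_le (φ : 𝓢(V, ℂ)) : ‖L φ‖ ≤ q φ :=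
    (norm_integral_le_lintegral_norm _).trans
      (ENNReal.toReal_le_of_le_ofReal (apply_nonneg q φ) (by simpa only [ofReal_norm] using hle φ))
  have continuous_norm : Continuous fun φ => ‖L φ‖ :=
    Seminorm.continuous_of_le (p := (normSeminorm ℂ E).comp L) hq norm_le
  refine ⟨⟨L, continuous_of_continuousAt_zero L ?_⟩, fun φ => rfl⟩
  rw [ContinuousAt, map_zero, tendsto_zero_iff_norm_tendsto_zero]
  simpa using continuous_norm.tendsto 0

variable {d : ℕ} {E₀ E₁ E₂ : Type*} [NormedAddCommGroup E₀] [NormedSpace ℂ E₀]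
  [NormedAddCommGroup E₁] [NormedSpace ℂ E₁] [NormedAddCommGroup E₂] [NormedSpace ℂ E₂]
  {B : E₀ →L[ℂ] E₁ →L[ℂ] E₂} {u : 𝓢'(Rd d, E₀)} {f : 𝓢'(Rd d, E₁)}

/-- The convolutions `(u * φ) * (f * ψ)` of the smoothings of `u` and `f` converge absolutely at
the origin, with bounds that are continuous in the windows `φ` and `ψ` and grow at most
polynomially under modulations of `φ`. -/
def IsConvolvable (B : E₀ →L[ℂ] E₁ →L[ℂ] E₂) (u : 𝓢'(Rd d, E₀)) (f : 𝓢'(Rd d, E₁)) : Prop :=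
  ∃ (q₁ q₂ : Seminorm ℂ 𝓢(Rd d, ℂ)) (t : ℝ), Continuous q₁ ∧ Continuous q₂ ∧ ∀ φ ψ η,
    ∫⁻ y, ‖B (smoothing u (modulate η φ) (-y)) (smoothing f ψ y)‖ₑ ≤
      ENNReal.ofReal (q₁ φ) * ENNReal.ofReal (q₂ ψ) * weight t η

/-- The value `((u * φ) * (f * ψ)) 0`. -/
def convAtZero (B : E₀ →L[ℂ] E₁ →L[ℂ] E₂) (u : 𝓢'(Rd d, E₀)) (f : 𝓢'(Rd d, E₁))
    (φ ψ : 𝓢(Rd d, ℂ)) : E₂ :=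
  ∫ y, B (smoothing u φ (-y)) (smoothing f ψ y)

lemma continuous_bilin_smoothing (B : E₀ →L[ℂ] E₁ →L[ℂ] E₂) (u : 𝓢'(Rd d, E₀))
    (f : 𝓢'(Rd d, E₁)) (φ ψ : 𝓢(Rd d, ℂ)) :
    Continuous fun y => B (smoothing u φ (-y)) (smoothing f ψ y) :=
  (B.continuous.comp ((continuous_smoothing u φ).comp continuous_neg)).clm_apply
    (continuous_smoothing f ψ)

lemma convAtZero_translate (B : E₀ →L[ℂ] E₁ →L[ℂ] E₂) (u : 𝓢'(Rd d, E₀)) (f : 𝓢'(Rd d, E₁))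
    (w : Rd d) (φ ψ : 𝓢(Rd d, ℂ)) :
    convAtZero B u f (translate w φ) ψ = convAtZero B u f φ (translate w ψ) := by
  rw [convAtZero, ← integral_sub_right_eq_self _ w, convAtZero]
  simp only [smoothing_translate, neg_sub, sub_sub_cancel_left]

lemma stronglyMeasurable_diag_of_continuous {X Y : Type*} [TopologicalSpace X]
    [SecondCountableTopology X] [MeasurableSpace X] [OpensMeasurableSpace X]
    [TopologicalSpace.MetrizableSpace X] [TopologicalSpace Y]
    [TopologicalSpace.PseudoMetrizableSpace Y] {F : X → X → Y}
    (hF_left : ∀ y, Continuous fun x => F x y) (hF_right : ∀ x, Continuous (F x)) :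
    StronglyMeasurable fun x => F x x :=
  (stronglyMeasurable_uncurry_of_continuous_of_stronglyMeasurable hF_left
    fun x => (hF_right x).stronglyMeasurable).comp_measurable
      (measurable_id.prodMk measurable_id)

lemma exists_schwartzMap_ne_zero (d : ℕ) : ∃ χ : 𝓢(Rd d, ℂ), χ ≠ 0 := by
  let b : ContDiffBump (0 : Rd d) := default
  have hasCompactSupport : HasCompactSupport (Complex.ofRealCLM ∘ b) :=
    b.hasCompactSupport.comp_left rfl
  refine ⟨hasCompactSupport.toSchwartzMap (Complex.ofRealCLM.contDiff.comp b.contDiff),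
    fun h => ?_⟩
  simpa [b.one_of_mem_closedBall, b.rIn_pos.le] using DFunLike.congr_fun h 0

namespace IsConvolvable

lemma exists_lintegral_le (h : IsConvolvable B u f) :
    ∃ q₁ q₂ : Seminorm ℂ 𝓢(Rd d, ℂ), Continuous q₁ ∧ Continuous q₂ ∧ ∀ φ ψ,
      ∫⁻ y, ‖B (smoothing u φ (-y)) (smoothing f ψ y)‖ₑ ≤
        ENNReal.ofReal (q₁ φ) * ENNReal.ofReal (q₂ ψ) := by
  obtain ⟨q₁, q₂, t, hq₁, hq₂, hle⟩ := h
  exact ⟨q₁, q₂, hq₁, hq₂, fun φ ψ => by simpa [weight_apply_zero] using hle φ ψ 0⟩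

lemma integrable (h : IsConvolvable B u f) (φ ψ : 𝓢(Rd d, ℂ)) :
    Integrable fun y => B (smoothing u φ (-y)) (smoothing f ψ y) := by
  obtain ⟨q₁, q₂, -, -, hle⟩ := h.exists_lintegral_le
  exact ⟨(continuous_bilin_smoothing B u f φ ψ).aestronglyMeasurable,
    (hle φ ψ).trans_lt (by finiteness)⟩

lemma exists_clm_left (h : IsConvolvable B u f) (ψ : 𝓢(Rd d, ℂ)) :
    ∃ L : 𝓢(Rd d, ℂ) →L[ℂ] E₂, ∀ φ, L φ = convAtZero B u f φ ψ := by
  obtain ⟨q₁, q₂, hq₁, -, hle⟩ := h.exists_lintegral_le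
  refine exists_clm_eq_integral (m := volume)
    (A := fun y => B.flip (smoothing f ψ y) ∘L smoothingCLM u (-y))
    (q := (q₂ ψ).toNNReal • q₁)
    (fun φ => (continuous_bilin_smoothing B u f φ ψ).aestronglyMeasurable)
    (hq₁.const_smul _) fun φ => ?_
  rw [ofReal_smul_seminorm, mul_comm]
  exact hle φ ψ

lemma exists_clm_right (h : IsConvolvable B u f) (φ : 𝓢(Rd d, ℂ)) :
    ∃ L : 𝓢(Rd d, ℂ) →L[ℂ] E₂, ∀ ψ, L ψ = convAtZero B u f φ ψ := by
  obtain ⟨q₁, q₂, -, hq₂, hle⟩ := h.exists_lintegral_le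
  refine exists_clm_eq_integral (m := volume)
    (A := fun y => B (smoothing u φ (-y)) ∘L smoothingCLM f y) (q := (q₁ φ).toNNReal • q₂)
    (fun ψ => (continuous_bilin_smoothing B u f φ ψ).aestronglyMeasurable)
    (hq₂.const_smul _) fun ψ => ?_
  rw [ofReal_smul_seminorm]
  exact hle φ ψ

lemma convAtZero_schwartzConv [CompleteSpace E₂] (h : IsConvolvable B u f)
    (φ χ ψ : 𝓢(Rd d, ℂ)) :
    convAtZero B u f (schwartzConv φ χ) ψ = convAtZero B u f φ (schwartzConv ψ χ) := by
  obtain ⟨L, hL⟩ := h.exists_clm_left ψ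
  obtain ⟨R, hR⟩ := h.exists_clm_right φ
  rw [← hL, ← hR, (isSchwartzIntegral_schwartzConv φ χ).map_eq L,
    (isSchwartzIntegral_schwartzConv ψ χ).map_eq R]
  simp only [L.map_smul, R.map_smul, hL, hR, convAtZero_translate]

lemma stronglyMeasurable_convAtZero_modulate (h : IsConvolvable B u f) (a ρ θ : 𝓢(Rd d, ℂ)) :
    StronglyMeasurable fun ξ =>
      convAtZero B u f (modulate ξ a) (schwartzConv (modulate ξ ρ) θ) := by
  choose L hL using h.exists_clm_left
  choose R hR using h.exists_clm_right
  refine stronglyMeasurable_diag_of_continuous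
    (F := fun ζ ξ => convAtZero B u f (modulate ξ a) (schwartzConv (modulate ζ ρ) θ))
    (fun ξ => ?_) fun ζ => ?_
  · simp only [← hR, schwartzConv_comm _ θ]
    exact (R (modulate ξ a)).continuous.comp
      ((SchwartzMap.convolution (ContinuousLinearMap.mul ℂ ℂ) θ).continuous.comp
        (continuous_modulate ρ))
  · simp only [← hL]
    exact (L _).continuous.comp (continuous_modulate a)

lemma exists_lintegral_convAtZero_modulate_le (h : IsConvolvable B u f) (a ρ : 𝓢(Rd d, ℂ)) :
    ∃ q : Seminorm ℂ 𝓢(Rd d, ℂ), Continuous q ∧ ∀ θ,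
      ∫⁻ ξ, ‖convAtZero B u f (modulate ξ a) (schwartzConv (modulate ξ ρ) θ)‖ₑ ≤
        ENNReal.ofReal (q θ) := by
  obtain ⟨q₁, q₂, t, -, hq₂, hle⟩ := h
  obtain ⟨M, hM⟩ := exists_nat_gt (d + t)
  obtain ⟨q, hq, hq_le⟩ := exists_continuous_seminorm_schwartzConv_modulate_le_weight ρ M hq₂
  have integral_ne_top := lintegral_weight_neg_ne_top (lt_sub_iff_add_lt.2 hM)
  let c : ℝ≥0 := (q₁ a).toNNReal * (∫⁻ ξ : Rd d, weight (-(M - t)) ξ).toNNReal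
  refine ⟨c • q, hq.const_smul c, fun θ => ?_⟩
  have integrand_le (ξ : Rd d) :
      ‖convAtZero B u f (modulate ξ a) (schwartzConv (modulate ξ ρ) θ)‖ₑ ≤
        ENNReal.ofReal (q₁ a) * ENNReal.ofReal (q θ) * weight (-(M - t)) ξ := by
    rw [convAtZero, neg_sub, sub_eq_add_neg, weight_add_exponent, schwartzConv_comm]
    grw [enorm_integral_le_lintegral_enorm, hle, hq_le]
    exact le_of_eq (by ring)
  refine (lintegral_mono integrand_le).trans_eq ?_
  rw [lintegral_const_mul' _ _ (by finiteness), ofReal_smul_seminorm, ENNReal.coe_mul,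
    ENNReal.coe_toNNReal integral_ne_top]
  exact mul_right_comm _ _ _

lemma exists_clm_schwartzConv_eq_convAtZero [CompleteSpace E₂] (h : IsConvolvable B u f) :
    ∃ L : 𝓢(Rd d, ℂ) →L[ℂ] E₂, ∀ φ ψ, L (schwartzConv φ ψ) = convAtZero B u f φ ψ := by
  obtain ⟨ρ, hρ⟩ := exists_schwartzMap_ne_zero d
  let a := involution ρ
  let c := schwartzConv ρ a 0
  have hc : c ≠ 0 := schwartzConv_involution_zero_ne_zero hρ
  choose L hL using h.exists_clm_left
  choose R hR using h.exists_clm_right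
  obtain ⟨q, hq, hle⟩ := h.exists_lintegral_convAtZero_modulate_le a ρ
  let A (ξ : Rd d) : 𝓢(Rd d, ℂ) →L[ℂ] E₂ :=
    R (modulate ξ a) ∘L SchwartzMap.convolution (ContinuousLinearMap.mul ℂ ℂ) (modulate ξ ρ)
  have A_apply (ξ : Rd d) (θ : 𝓢(Rd d, ℂ)) : A ξ θ =
      convAtZero B u f (modulate ξ a) (schwartzConv (modulate ξ ρ) θ) := hR _ _
  obtain ⟨T, hT⟩ : ∃ T : 𝓢(Rd d, ℂ) →L[ℂ] E₂, ∀ θ, T θ = ∫ ξ, A ξ θ := by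
    refine exists_clm_eq_integral (fun θ => ?_) hq fun θ => ?_
    · simp only [A_apply]
      exact (h.stronglyMeasurable_convAtZero_modulate a ρ θ).aestronglyMeasurable
    · simpa only [A_apply] using hle θ
  refine ⟨c⁻¹ • T, fun φ ψ => ?_⟩
  have window_eq (ξ : Rd d) : schwartzConv (modulate ξ ρ) (schwartzConv φ ψ) =
      schwartzConv ψ (schwartzConv φ (modulate ξ ρ)) := by
    rw [schwartzConv_comm, schwartzConv_comm φ ψ, schwartzConv_assoc]
  have integrand_eq (ξ : Rd d) : A ξ (schwartzConv φ ψ) =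
      L ψ (schwartzConv φ (modulate ξ (schwartzConv ρ a))) := by
    rw [A_apply, hL, window_eq, ← h.convAtZero_schwartzConv, modulate_schwartzConv,
      schwartzConv_comm (modulate ξ a), schwartzConv_assoc]
  have T_eq : T (schwartzConv φ ψ) = c • convAtZero B u f φ ψ := by
    rw [hT, ← hL, ← (L ψ).map_smul,
      (isSchwartzIntegral_schwartzConv_modulate φ (schwartzConv ρ a)).map_eq (L ψ)]
    exact integral_congr_ae (.of_forall integrand_eq)
  rw [smul_apply, T_eq, inv_smul_smul₀ hc]

theorem exists_isConvolution [CompleteSpace E₂] (h : IsConvolvable B u f) :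
    ∃ v : 𝓢'(Rd d, E₂), IsConvolution B u f v := by
  obtain ⟨L, hL⟩ := h.exists_clm_schwartzConv_eq_convAtZero
  let v : 𝓢'(Rd d, E₂) := (L ∘L reflectAt 0 : 𝓢(Rd d, ℂ) →L[ℂ] E₂)
  refine ⟨v, fun φ ψ x => ?_⟩
  have integrand_eq (y : Rd d) : B (smoothing u φ (x - y)) (smoothing f ψ y) =
      B (smoothing u (translate (-x) φ) (-y)) (smoothing f ψ y) := by
    rw [smoothing_translate, sub_neg_eq_add, neg_add_eq_sub]
  simp only [integrand_eq]
  refine ⟨h.integrable _ _, (hL _ _).symm.trans ?_⟩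
  have reflectAt_reflectAt : reflectAt 0 (reflectAt x (schwartzConv φ ψ)) =
      schwartzConv (translate (-x) φ) ψ := by
    rw [← translate_schwartzConv]
    ext y
    simp [reflectAt_apply, add_comm]
  rw [← reflectAt_reflectAt]
  rfl

end IsConvolvable

end Existence

/-! ### Convolution of amalgam and modulation spaces -/

section Multiplier

variable {d : ℕ} {E₀ E₁ E₂ : Type*} [NormedAddCommGroup E₀] [NormedSpace ℂ E₀]
  [NormedAddCommGroup E₁] [NormedSpace ℂ E₁] [NormedAddCommGroup E₂] [NormedSpace ℂ E₂]
  {B : E₀ →L[ℂ] E₁ →L[ℂ] E₂} {u μ : 𝓢'(Rd d, E₀)} {f : 𝓢'(Rd d, E₁)} {h : 𝓢'(Rd d, E₂)}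
  {p q : ℝ≥0∞} {r s δ : ℝ}

lemma isConvolvable_of_mixedNorm_lt_top (B : E₀ →L[ℂ] E₁ →L[ℂ] E₂) (hp : 1 ≤ p) (hq : 1 ≤ q)
    {γ₀ γ₁ : 𝓢(Rd d, ℂ)} (hγ₀ : γ₀ ≠ 0) (hγ₁ : γ₁ ≠ 0)
    (hu : mixedNorm 1 ∞ |r| δ (amplitude u γ₀) < ∞)
    (hf : mixedNorm p q r s (amplitude f γ₁) < ∞) : IsConvolvable B u f := by
  obtain ⟨Q₁, hQ₁, hu_le⟩ := exists_continuous_seminorm_amplitude_le le_rfl le_top hγ₀ hu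
  obtain ⟨Q₂, hQ₂, hf_le⟩ := exists_continuous_seminorm_amplitude_le hp hq hγ₁ hf
  refine ⟨‖B‖₊ • Q₁, Q₂, -δ, hQ₁.const_smul ‖B‖₊, hQ₂, fun φ ψ η => ?_⟩
  have smoothing_le (y : Rd d) :
      ‖smoothing f ψ y‖ₑ ≤ ENNReal.ofReal (Q₂ ψ) * weight |r| (-y) := by
    have h_zero := (hf_le ψ 0).1 y
    rw [amplitude_zero_right, weight_apply_zero, mul_one] at h_zero
    grw [h_zero, weight_neg, weight_mono (neg_le_abs r)]
  have integrand_le (y : Rd d) : ‖B (smoothing u (modulate η φ) (-y)) (smoothing f ψ y)‖ₑ ≤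
      ‖B‖ₑ * ENNReal.ofReal (Q₂ ψ) * (weight |r| (-y) * amplitude u φ (-y) η) := by
    grw [B.le_opENorm₂, smoothing_le]
    exact le_of_eq (by rw [amplitude]; ring)
  calc _ ≤ ∫⁻ y, ‖B‖ₑ * ENNReal.ofReal (Q₂ ψ) * (weight |r| (-y) * amplitude u φ (-y) η) :=
        lintegral_mono integrand_le
    _ = ‖B‖ₑ * ENNReal.ofReal (Q₂ ψ) * weightedNorm 1 |r| (fun y => amplitude u φ y η) := by
        rw [lintegral_const_mul' _ _ (by finiteness), weightedNorm_one,
          lintegral_neg_eq_self (fun y : Rd d => weight |r| y * amplitude u φ y η)]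
    _ ≤ ‖B‖ₑ * ENNReal.ofReal (Q₂ ψ) * (ENNReal.ofReal (Q₁ φ) * weight (-δ) η) := by
        gcongr
        exact (hu_le φ η).2
    _ = _ := by
        rw [ofReal_smul_seminorm, ← enorm_eq_nnnorm]
        ring

lemma IsConvolution.amplitude_le (hh : IsConvolution B u f h) (φ ψ : 𝓢(Rd d, ℂ)) (x ξ : Rd d) :
    amplitude h (schwartzConv φ ψ) x ξ ≤
      ‖B‖ₑ * ∫⁻ z, amplitude f ψ (x - z) ξ * amplitude u φ z ξ := by
  rw [amplitude, modulate_schwartzConv, ← (hh (modulate ξ φ) (modulate ξ ψ) x).2,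
    ← lintegral_const_mul' _ _ enorm_ne_top]
  refine (enorm_integral_le_lintegral_enorm _).trans ?_
  rw [← lintegral_sub_left_eq_self _ x]
  refine lintegral_mono fun z => (B.le_opENorm₂ _ _).trans_eq ?_
  rw [sub_sub_cancel, amplitude, amplitude]
  ring

lemma IsConvolution.weightedNorm_amplitude_le (hh : IsConvolution B u f h) (φ ψ : 𝓢(Rd d, ℂ))
    (hp : 1 ≤ p) (r : ℝ) (ξ : Rd d) :
    weightedNorm p r (fun x => amplitude h (schwartzConv φ ψ) x ξ) ≤
      ENNReal.ofReal (2 ^ |r|) * ‖B‖ₑ * weightedNorm 1 |r| (fun x => amplitude u φ x ξ) *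
        weightedNorm p r (fun x => amplitude f ψ x ξ) := by
  have hu : Measurable fun x => amplitude u φ x ξ := (measurable_amplitude u φ).of_uncurry_right
  have hf : Measurable fun x => amplitude f ψ x ξ := (measurable_amplitude f ψ).of_uncurry_right
  refine (weightedNorm_le_const_mul (measurable_lintegral_sub_mul hf hu)
    (.of_forall (hh.amplitude_le φ ψ · ξ)) p r).trans ?_
  grw [weightedNorm_lintegral_sub_mul_le (a := fun x => amplitude f ψ x ξ) hp r hf hu]
  exact le_of_eq (by ring)

theorem IsConvolution.mixedNorm_amplitude_le (hh : IsConvolution B u f h) (φ ψ : 𝓢(Rd d, ℂ))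
    (hp : 1 ≤ p) (q : ℝ≥0∞) (r s δ : ℝ) :
    mixedNorm p q r (s + δ) (amplitude h (schwartzConv φ ψ)) ≤
      ENNReal.ofReal (2 ^ |r|) * ‖B‖ₑ * mixedNorm 1 ∞ |r| δ (amplitude u φ) *
        mixedNorm p q r s (amplitude f ψ) := by
  have hf := measurable_weightedNorm_left (measurable_amplitude f ψ) p r
  have hu_le : ∀ᵐ ξ, weight δ ξ * weightedNorm 1 |r| (fun x => amplitude u φ x ξ) ≤
      mixedNorm 1 ∞ |r| δ (amplitude u φ) := ae_le_eLpNorm_top _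
  refine eLpNorm_le_const_mul ((measurable_weight s).mul hf) (hu_le.mono fun ξ hξ => ?_) q
  calc weight (s + δ) ξ * weightedNorm p r (fun x => amplitude h (schwartzConv φ ψ) x ξ)
      ≤ weight (s + δ) ξ * (ENNReal.ofReal (2 ^ |r|) * ‖B‖ₑ *
          weightedNorm 1 |r| (fun x => amplitude u φ x ξ) *
            weightedNorm p r (fun x => amplitude f ψ x ξ)) := by
        gcongr
        exact hh.weightedNorm_amplitude_le φ ψ hp r ξ
    _ = ENNReal.ofReal (2 ^ |r|) * ‖B‖ₑ *
          (weight δ ξ * weightedNorm 1 |r| fun x => amplitude u φ x ξ) *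
            (weight s ξ * weightedNorm p r fun x => amplitude f ψ x ξ) := by
        rw [weight_add_exponent]
        ring
    _ ≤ _ := by
        gcongr
        exact le_rfl

lemma MemModulation.modulationNorm_lt_top (hf : MemModulation p q r s f) (hp : 1 ≤ p) (hq : 1 ≤ q)
    (g : 𝓢(Rd d, ℂ)) : modulationNorm g p q r s f < ∞ := by
  obtain ⟨g', hg', hf⟩ := hf
  obtain ⟨C, hC⟩ :=
    exists_mixedNorm_amplitude_le hp hq r s (involution_ne_zero hg') (involution g)
  rw [modulationNorm_eq_mixedNorm] at hf ⊢
  exact (hC f).trans_lt (by finiteness)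

lemma MemAmalgam.amalgamNorm_lt_top (hμ : MemAmalgam p q r s μ) (hp : 1 ≤ p) (hq : 1 ≤ q)
    (g : 𝓢(Rd d, ℂ)) : amalgamNorm g p q r s μ < ∞ := by
  obtain ⟨g', hg', hμ⟩ := hμ
  obtain ⟨C, hC⟩ := exists_mixedNorm_amplitude_le hp hq r s (dualWindow_ne_zero hg') (dualWindow g)
  rw [amalgamNorm_eq_mixedNorm] at hμ ⊢
  exact (hC (𝓕⁻ μ)).trans_lt (by finiteness)

lemma MemAmalgam.isConvolvable (hμ : MemAmalgam 1 ∞ |r| δ μ) (hp : 1 ≤ p) (hq : 1 ≤ q)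
    (hf : MemModulation p q r s f) (B : E₀ →L[ℂ] E₁ →L[ℂ] E₂) : IsConvolvable B (𝓕⁻ μ) f := by
  obtain ⟨g₀, hg₀, hμ⟩ := hμ
  obtain ⟨g₁, hg₁, hf⟩ := hf
  rw [amalgamNorm_eq_mixedNorm] at hμ
  rw [modulationNorm_eq_mixedNorm] at hf
  exact isConvolvable_of_mixedNorm_lt_top B hp hq (dualWindow_ne_zero hg₀)
    (involution_ne_zero hg₁) hμ hf

theorem exists_modulationNorm_le_of_isConvolution (hp : 1 ≤ p) (hq : 1 ≤ q) (r s δ : ℝ)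
    {g₀ g₁ : 𝓢(Rd d, ℂ)} (hg₀ : g₀ ≠ 0) (hg₁ : g₁ ≠ 0) (g₂ : 𝓢(Rd d, ℂ)) :
    ∃ C : ℝ≥0, ∀ {E₀ E₁ E₂ : Type*} [NormedAddCommGroup E₀] [NormedSpace ℂ E₀]
      [NormedAddCommGroup E₁] [NormedSpace ℂ E₁] [NormedAddCommGroup E₂] [NormedSpace ℂ E₂]
      {B : E₀ →L[ℂ] E₁ →L[ℂ] E₂} {μ : 𝓢'(Rd d, E₀)} {f : 𝓢'(Rd d, E₁)} {h : 𝓢'(Rd d, E₂)},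
      IsConvolution B (𝓕⁻ μ) f h → modulationNorm g₂ p q r (s + δ) h ≤
        C * ‖B‖ₑ * amalgamNorm g₀ 1 ∞ |r| δ μ * modulationNorm g₁ p q r s f := by
  let γ := involution g₁
  have hγ : γ ≠ 0 := involution_ne_zero hg₁
  have hκ : schwartzConv γ (involution γ) ≠ 0 := fun h_zero =>
    schwartzConv_involution_zero_ne_zero hγ (by rw [h_zero, zero_apply])
  obtain ⟨C₀, hC₀⟩ := exists_mixedNorm_amplitude_le le_rfl le_top |r| δ (dualWindow_ne_zero hg₀) γ
  obtain ⟨C₁, hC₁⟩ := exists_mixedNorm_amplitude_le hp hq r s hγ (involution γ)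
  obtain ⟨C₂, hC₂⟩ := exists_mixedNorm_amplitude_le hp hq r (s + δ) hκ (involution g₂)
  refine ⟨C₂ * ((2 : ℝ) ^ |r|).toNNReal * C₀ * C₁, fun {E₀ E₁ E₂} _ _ _ _ _ _ B μ f h hh => ?_⟩
  simp only [modulationNorm_eq_mixedNorm, amalgamNorm_eq_mixedNorm]
  grw [hC₂ h, hh.mixedNorm_amplitude_le γ (involution γ) hp, hC₀ (𝓕⁻ μ), hC₁ f]
  refine le_of_eq ?_
  rw [ENNReal.coe_mul, ENNReal.coe_mul, ENNReal.coe_mul, ENNReal.ofReal]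
  ring

lemma IsConvolution.exists_fourierMultiplier_eq (hh : IsConvolution B (𝓕⁻ μ) f h) :
    ∃ hf : f ∈ (fourierMultiplier B μ).domain, fourierMultiplier B μ ⟨f, hf⟩ = h := by
  have mem_graph := mem_fourierMultiplier_graph_iff.2 hh
  have mem_domain := LinearPMap.mem_domain_of_mem_graph mem_graph
  exact ⟨mem_domain, LinearPMap.mem_graph_snd_inj _
    ((fourierMultiplier B μ).mem_graph ⟨f, mem_domain⟩) mem_graph rfl⟩

end Multiplier

end TimeFrequency

end

theorem mainTheorem10_general (d : ℕ) (p q : ℝ≥0∞) (hp : 1 ≤ p) (hq : 1 ≤ q) (r s δ : ℝ)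
    (g₀ g₁ g₂ : 𝓢(Rd d, ℂ)) (hg₀ : g₀ ≠ 0) (hg₁ : g₁ ≠ 0) (hg₂ : g₂ ≠ 0) :
    ∃ C : ℝ≥0,
      ∀ (E₀ : Type u₀) [NormedAddCommGroup E₀] [NormedSpace ℂ E₀]
        (E₁ : Type u₁) [NormedAddCommGroup E₁] [NormedSpace ℂ E₁]
        (E₂ : Type u₂) [NormedAddCommGroup E₂] [NormedSpace ℂ E₂] [CompleteSpace E₂]
        (B : E₀ →L[ℂ] E₁ →L[ℂ] E₂)
        (μ : 𝓢'(Rd d, E₀)) (_ : MemAmalgam 1 ∞ |r| δ μ)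
        (f : 𝓢'(Rd d, E₁)) (_ : MemModulation p q r s f),
        ∃ hf : f ∈ (fourierMultiplier B μ).domain,
          MemModulation p q r (s + δ) (fourierMultiplier B μ ⟨f, hf⟩) ∧
          modulationNorm g₂ p q r (s + δ) (fourierMultiplier B μ ⟨f, hf⟩) ≤
            C * ‖B‖ₑ * amalgamNorm g₀ 1 ∞ |r| δ μ * modulationNorm g₁ p q r s f := by
  obtain ⟨C, hC⟩ := exists_modulationNorm_le_of_isConvolution hp hq r s δ hg₀ hg₁ g₂
  refine ⟨C, fun E₀ _ _ E₁ _ _ E₂ _ _ _ B μ hμ f hf => ?_⟩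
  obtain ⟨h, hh⟩ := (hμ.isConvolvable hp hq hf B).exists_isConvolution
  obtain ⟨f_mem, h_eq⟩ := hh.exists_fourierMultiplier_eq
  have hμ_fin := hμ.amalgamNorm_lt_top le_rfl le_top g₀
  have hf_fin := hf.modulationNorm_lt_top hp hq g₁
  rw [← h_eq] at hh
  exact ⟨f_mem, ⟨g₂, hg₂, (hC hh).trans_lt (by finiteness)⟩, hC hh⟩

theorem mainTheorem10 (d : ℕ) (p q : ℝ≥0∞) (hp : 1 ≤ p) (hq : 1 ≤ q) (r s δ : ℝ)
    (g₀ g₁ g₂ : 𝓢(Rd d, ℂ)) (hg₀ : g₀ ≠ 0) (hg₁ : g₁ ≠ 0) (hg₂ : g₂ ≠ 0) :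
    ∃ C : ℝ≥0,
      ∀ (E₀ : Type u₀) [NormedAddCommGroup E₀] [NormedSpace ℂ E₀] [CompleteSpace E₀]
        (E₁ : Type u₁) [NormedAddCommGroup E₁] [NormedSpace ℂ E₁] [CompleteSpace E₁]
        (E₂ : Type u₂) [NormedAddCommGroup E₂] [NormedSpace ℂ E₂] [CompleteSpace E₂]
        (B : E₀ →L[ℂ] E₁ →L[ℂ] E₂) (_ : ‖B‖ ≤ 1)
        (μ : 𝓢'(Rd d, E₀)) (_ : MemAmalgam 1 ∞ |r| δ μ)
        (f : 𝓢'(Rd d, E₁)) (_ : MemModulation p q r s f),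
        ∃ hf : f ∈ (fourierMultiplier B μ).domain,
          MemModulation p q r (s + δ) (fourierMultiplier B μ ⟨f, hf⟩) ∧
          modulationNorm g₂ p q r (s + δ) (fourierMultiplier B μ ⟨f, hf⟩) ≤
            C * amalgamNorm g₀ 1 ∞ |r| δ μ * modulationNorm g₁ p q r s f := by
  obtain ⟨C, hC⟩ := mainTheorem10_general d p q hp hq r s δ g₀ g₁ g₂ hg₀ hg₁ hg₂
  refine ⟨C, fun E₀ _ _ _ E₁ _ _ _ E₂ _ _ _ B hB μ hμ f hf => ?_⟩
  obtain ⟨f_mem, h_mem, h_le⟩ := hC E₀ E₁ E₂ B μ hμ f hf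
  have hB' : ‖B‖ₑ ≤ 1 := by simpa [← ofReal_norm] using hB
  exact ⟨f_mem, h_mem, by grw [h_le, hB', mul_one]⟩
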